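/- Consider a downlink with $K\ge 1$ strong users and one weak user (user $K+1$), a base station with $N_B\ge K+1$ antennas and a reconfigurable intelligent surface (RIS) with $N_R\ge 1$ elements. Let $L_G>0$, $L_{d,k}>0$ ($k\le K$), $L_{r,k}>0$ ($k\le K+1$) be pathlosses and $\bar p>0$ the power per user; let $a\in\mathbb{C}^{N_R}$, $b\in\mathbb{C}^{N_B}$ be fixed with $\|a\|_2^2=N_R$, $\|b\|_2=1$. The base station–RIS channel is $\sqrt{L_GN_B}\,ab^{H}$. The strong users' direct channels $h_{d,k}\sim\mathcal{N}_{\mathbb{C}}(0,L_{d,k}I)$, $k\le K$, and the RIS–user channels $h_{r,k}\sim\mathcal{N}_{\mathbb{C}}(0,L_{r,k}I)$, $k\le K+1$, are mutually independent (i.i.d. Rayleigh fading; $\mathcal{N}_{\mathbb{C}}$ is the circularly symmetric complex Gaussian law), and the weak user has no direct channel. The phase-shift vector $\theta\in\mathbb{C}^{N_R}$ has entries of modulus one and is either random and independent of all channels (random phase shifts) or deterministic (statistical phase shifts). Put $h_{c,k}^{H}=\sqrt{L_GN_B}\,h_{r,k}^{H}\operatorname{diag}(a)$, let $H_d$ and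 $H_c$ be the matrices with rows $h_{d,k}^{H}$ and $h_{c,k}^{H}$, $k\le K$, and set $$C_s=H_d(I-bb^{H})H_d^{H},\qquad D_s=[H_c,\;H_db],\qquad \bar\theta=\begin{bmatrix}\theta\\1\end{bmatrix}.$$ The parts of the high-SNR spectral efficiencies of linear (zero-forcing) precoding and of dirty paper coding (DPC) that depend on the RIS are $$SE_{Lin,r}=\log_2\!\left(\frac{|h_{c,K+1}^{H}\theta|^2\,\bar p}{1+\bar\theta^{H}D_s^{H}C_s^{-1}D_s\bar\theta}\right),\qquad SE_{DPC,r}=\log_2\!\left(|h_{c,K+1}^{H}\theta|^2\,\bar p\right).$$ Then both are integrable, $$\mathbb{E}[SE_{Lin,r}]\le\log_2\!\left(N_B\,\frac{L_{r,K+1}\,\bar p}{\sum_{k=1}^{K}L_{r,k}/L_{d,k}}\right),$$ a bound that does not depend on $N_R$, and $$\mathbb{E}[SE_{DPC,r}]=\log_2\!\left(e^{-\gamma}L_GL_{r,K+1}N_BN_R\,\bar p\right),$$ where $\gamma$ is the Euler–Mascheroni constant; the latter value is strictly increasing in $N_R$. -/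

import Mathlib

open MeasureTheory ProbabilityTheory
open scoped Matrix

noncomputable section

namespace RISDownlink

/-- The circularly symmetric complex normal law with mean `0` and variance `L` (so that
`E |z| ^ 2 = L`): real and imaginary part are independent real Gaussians of variance `L / 2`. -/
def complexNormal (L : ℝ) : Measure ℂ :=
  ((gaussianReal 0 (L / 2).toNNReal).prod (gaussianReal 0 (L / 2).toNNReal)).map
    Complex.measurableEquivRealProd.symm

/-- The law of a circularly symmetric complex Gaussian vector of length `n` with mean `0` and
covariance matrix `L • I` (i.i.d. Rayleigh fading with pathloss `L`). -/
def iidRayleigh (n : ℕ) (L : ℝ) : Measure (Fin n → ℂ) :=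
  Measure.pi fun _ => complexNormal L

section Channel

variable {K NB NR : ℕ}

/-- The cascaded channel of a user, as the row vector `h_c^H = √(L_G N_B) h_r^H diag(a)`. -/
def cascadedRow (NB : ℕ) (LG : ℝ) (a : Fin NR → ℂ) (hr : Fin NR → ℂ) : Fin NR → ℂ :=
  ((Real.sqrt (LG * NB) : ℝ) : ℂ) • (star hr ᵥ* Matrix.diagonal a)

/-- The matrix of the strong users' direct channels, with rows `h_{d,k}^H`. -/
def directStrong (hd : Fin K → Fin NB → ℂ) : Matrix (Fin K) (Fin NB) ℂ :=
  Matrix.of fun k => star (hd k)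

/-- The matrix of the strong users' cascaded channels, with rows `h_{c,k}^H`. The family `hr`
contains the RIS-user channels of all `K + 1` users; the weak user is the last one. -/
def cascadedStrong (NB : ℕ) (LG : ℝ) (a : Fin NR → ℂ) (hr : Fin (K + 1) → Fin NR → ℂ) :
    Matrix (Fin K) (Fin NR) ℂ :=
  Matrix.of fun k => cascadedRow NB LG a (hr k.castSucc)

/-- The orthogonal projector `P_b^⊥ = I - b b^H` (for a unit vector `b`). -/
def projOrth (b : Fin NB → ℂ) : Matrix (Fin NB) (Fin NB) ℂ :=
  1 - Matrix.vecMulVec b (star b)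

/-- `C_s = H_d P_b^⊥ H_d^H`, the Gram matrix of the strong direct channels without the
direction `b`. -/
def gramStrong (b : Fin NB → ℂ) (hd : Fin K → Fin NB → ℂ) : Matrix (Fin K) (Fin K) ℂ :=
  directStrong hd * projOrth b * (directStrong hd)ᴴ

/-- `D_s = [H_c, H_d b]`, for the strong users. -/
def Dstrong (LG : ℝ) (a : Fin NR → ℂ) (b : Fin NB → ℂ) (hd : Fin K → Fin NB → ℂ)
    (hr : Fin (K + 1) → Fin NR → ℂ) : Matrix (Fin K) (Fin NR ⊕ Unit) ℂ :=
  Matrix.fromCols (cascadedStrong NB LG a hr)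
    (Matrix.replicateCol Unit (directStrong hd *ᵥ b))

/-- The extended phase vector `[θ; 1]`. -/
def thetaBar (θ : Fin NR → ℂ) : Fin NR ⊕ Unit → ℂ :=
  Sum.elim θ 1

/-- The channel mitigation term `θ̄^H D_s^H C_s⁻¹ D_s θ̄` (a real number). -/
def mitigation (LG : ℝ) (a : Fin NR → ℂ) (b : Fin NB → ℂ) (hd : Fin K → Fin NB → ℂ)
    (hr : Fin (K + 1) → Fin NR → ℂ) (θ : Fin NR → ℂ) : ℝ :=
  (star (thetaBar θ) ⬝ᵥ
    (((Dstrong LG a b hd hr)ᴴ * (gramStrong b hd)⁻¹ * Dstrong LG a b hd hr) *ᵥ thetaBar θ)).re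

/-- The weak user's channel gain `|h_{c,K+1}^H θ| ^ 2`. -/
def weakGain (NB : ℕ) (LG : ℝ) (a : Fin NR → ℂ) (hr : Fin (K + 1) → Fin NR → ℂ)
    (θ : Fin NR → ℂ) : ℝ :=
  ‖cascadedRow NB LG a (hr (Fin.last K)) ⬝ᵥ θ‖ ^ 2

/-- The RIS part of the high-SNR spectral efficiency of linear (zero-forcing) precoding. -/
def SELinR (LG p : ℝ) (a : Fin NR → ℂ) (b : Fin NB → ℂ) (hd : Fin K → Fin NB → ℂ)
    (hr : Fin (K + 1) → Fin NR → ℂ) (θ : Fin NR → ℂ) : ℝ :=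
  Real.logb 2 (weakGain NB LG a hr θ * p / (1 + mitigation LG a b hd hr θ))

/-- The RIS part of the high-SNR spectral efficiency of dirty paper coding. -/
def SEDPCR (NB : ℕ) (LG p : ℝ) (a : Fin NR → ℂ) (hr : Fin (K + 1) → Fin NR → ℂ)
    (θ : Fin NR → ℂ) : ℝ :=
  Real.logb 2 (weakGain NB LG a hr θ * p)

end Channel

end RISDownlink

end

/-! For given unit-modulus phases, the scalars `w k = h_{c,k}^H θ` are independent complex Gaussians
of variance `σ k = LG * NB * NR * Lr k`, independent of the direct channels. This law does not
involve `θ`, so it also holds after averaging over random phases (`map_channels_eq`).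

For DPC only the weak user's scalar matters: `|w|^2 / σ` is standard exponential, and the mean of
its logarithm is `Γ'(1) = -γ`.

For linear precoding there is the additional loss `log (1 + v^H C_s⁻¹ v)` with `v = w + H_d b`, and
its mean must be bounded below by `log (∑ σ k / Ld k) - γ - log NB` (`le_integral_logLoss`).
Cauchy–Schwarz with a test vector `x` gives `|x^H v|^2 ≤ ‖H_d^H x‖^2 * (v^H C_s⁻¹ v)`. The law of
`w` is invariant under a common rotation `exp (i t)`, so one may average over `t`; by Jensen's
formula the mean of `log |exp (i t) s + g|` is at least `log s`, which removes the term `g = x^H H_d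
b`. The choice `x k = w k / Ld k` makes `x^H w` equal to `s = ∑ |w k|^2 / Ld k` and the mean of
`‖H_d^H x‖^2` equal to `NB * s`. Concavity of the logarithm then bounds the mean of `log s` below by
`log (∑ σ k / Ld k) - γ`. In the difference of the two terms, `γ` and the factor `LG * NB * NR`
cancel, so the final bound is free of `NR`.

Integrability of the loss needs control of `C_s⁻¹` near singular `C_s`. Cramer's rule bounds the
quadratic form by a polynomial over `|det (H_d Q)|^2`, where the columns of `Q` are orthogonal to
`b`, and the mean of `|det (H_d Q)|⁻¹` is finite (`lintegral_inv_norm_multilinearMap_le`). -/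

noncomputable section

namespace RISDownlink

/-! ### The complex normal law: density, exponential squared modulus, linear images. -/

section ComplexNormal

instance isProbabilityMeasure_complexNormal (L : ℝ) : IsProbabilityMeasure (complexNormal L) :=
  Measure.isProbabilityMeasure_map (by fun_prop)

instance isProbabilityMeasure_iidRayleigh (n : ℕ) (L : ℝ) :
    IsProbabilityMeasure (iidRayleigh n L) := by
  unfold iidRayleigh; infer_instance

theorem charFun_complexNormal {L : ℝ} (hL : 0 ≤ L) (t : ℂ) :
    charFun (complexNormal L) t = Complex.exp (-(L * ‖t‖ ^ 2 / 4 : ℝ)) := by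
  rw [charFun_apply, complexNormal, integral_map (by fun_prop)
    (Measurable.aestronglyMeasurable (by fun_prop))]
  have h : ∀ x : ℝ × ℝ, Complex.exp (inner ℝ (Complex.measurableEquivRealProd.symm x) t * Complex.I)
      = Complex.exp (t.re * x.1 * Complex.I) * Complex.exp (t.im * x.2 * Complex.I) := by
    intro x
    rw [← Complex.exp_add]
    congr 1
    simp [Complex.measurableEquivRealProd, Complex.inner]
    ring
  simp_rw [h]
  rw [integral_prod_mul (fun x : ℝ => Complex.exp (t.re * x * Complex.I))
    (fun x : ℝ => Complex.exp (t.im * x * Complex.I)), ← charFun_apply_real, ← charFun_apply_real,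
    charFun_gaussianReal, charFun_gaussianReal, ← Complex.exp_add]
  congr 1
  have h1 : (((L / 2).toNNReal : ℝ) : ℂ) = (L : ℂ) / 2 := by
    rw [Real.coe_toNNReal _ (by positivity)]
    push_cast; rfl
  rw [h1, Complex.sq_norm, Complex.normSq_apply]
  push_cast
  ring

theorem complexNormal_eq_withDensity {L : ℝ} (hL : 0 < L) :
    complexNormal L = volume.withDensity
      (fun z : ℂ => ENNReal.ofReal ((Real.pi * L)⁻¹ * Real.exp (-(‖z‖ ^ 2 / L)))) := by
  have hv : (L / 2).toNNReal ≠ 0 := by simpa using hL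
  unfold complexNormal
  rw [gaussianReal_of_var_ne_zero _ hv, prod_withDensity (by fun_prop) (by fun_prop)]
  refine Measure.ext_of_lintegral _ fun f hf => ?_
  rw [lintegral_map hf (by fun_prop), lintegral_withDensity_eq_lintegral_mul _ (by fun_prop)
    (by fun_prop), lintegral_withDensity_eq_lintegral_mul _ (by fun_prop) hf,
    ← Complex.volume_preserving_equiv_real_prod.symm.lintegral_comp (by fun_prop),
    ← Measure.volume_eq_prod]
  refine lintegral_congr fun x => ?_
  simp only [Pi.mul_apply]
  congr 1
  rw [gaussianPDF, gaussianPDF, gaussianPDFReal, gaussianPDFReal,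
    ← ENNReal.ofReal_mul (by positivity), Real.coe_toNNReal _ (by positivity)]
  congr 1
  rw [mul_mul_mul_comm, ← Real.exp_add, ← mul_inv, Real.mul_self_sqrt (by positivity)]
  congr 2
  · ring
  · rw [Complex.sq_norm, Complex.normSq_apply]
    simp [Complex.measurableEquivRealProd]
    field_simp
    ring

/-- Polar coordinates: the angle contributes the factor `2π`, and `t = r ^ 2 / L` turns the radial
density into `exp (-t)`. -/
theorem lintegral_norm_sq_complexNormal {L : ℝ} (hL : 0 < L) {f : ℝ → ENNReal}
    (hf : Measurable f) :
    ∫⁻ z, f (‖z‖ ^ 2 / L) ∂(complexNormal L)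
      = ∫⁻ t in Set.Ioi 0, ENNReal.ofReal (Real.exp (-t)) * f t := by
  rw [complexNormal_eq_withDensity hL, lintegral_withDensity_eq_lintegral_mul _ (by fun_prop)
    (by fun_prop), ← Complex.lintegral_comp_polarCoord_symm, polarCoord_target,
    Measure.volume_eq_prod, setLIntegral_prod]
  · have h1 : (fun r : ℝ => r ^ 2 / L) '' Set.Ioi 0 = Set.Ioi 0 := by
      ext t
      constructor
      · rintro ⟨r, hr, rfl⟩
        have : 0 < r := hr
        simp only [Set.mem_Ioi]; positivity
      · intro ht
        have : 0 < t := ht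
        refine ⟨√ (L * t), by simp only [Set.mem_Ioi]; positivity, ?_⟩
        simp only
        rw [Real.sq_sqrt (by positivity)]; field_simp
    conv_rhs => rw [← h1]
    rw [lintegral_image_eq_lintegral_abs_deriv_mul (f' := fun r => 2 * r / L) measurableSet_Ioi]
    · refine setLIntegral_congr_fun measurableSet_Ioi fun r hr => ?_
      have hr : 0 < r := hr
      simp only [Pi.mul_apply, Complex.norm_polarCoord_symm, abs_of_pos hr, smul_eq_mul,
        lintegral_const, Measure.restrict_apply_univ, Real.volume_Ioo]
      rw [abs_of_pos (by positivity), ← mul_assoc, ← mul_assoc,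
        ← ENNReal.ofReal_mul (by positivity), ← ENNReal.ofReal_mul (by positivity),
        mul_right_comm, ← ENNReal.ofReal_mul (by positivity)]
      congr 2
      field_simp
      ring
    · intro r hr
      have := ((hasDerivAt_pow 2 r).div_const L).hasDerivWithinAt (s := Set.Ioi 0)
      simpa using this
    · intro x hx y hy hxy
      have hx : 0 < x := hx
      have hy : 0 < y := hy
      simp only at hxy
      field_simp at hxy
      exact (pow_left_inj₀ hx.le hy.le two_ne_zero).1 hxy
  · refine Measurable.aemeasurable ?_
    simp only [Pi.mul_apply, Complex.norm_polarCoord_symm]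
    fun_prop

/-- The standard exponential law, with a convenient form of its density. -/
def stdExp : Measure ℝ :=
  (volume.restrict (Set.Ioi 0)).withDensity fun t => ENNReal.ofReal (Real.exp (-t))

theorem map_norm_sq_complexNormal {L : ℝ} (hL : 0 < L) :
    (complexNormal L).map (fun z => ‖z‖ ^ 2 / L) = stdExp := by
  refine Measure.ext_of_lintegral _ fun f hf => ?_
  rw [lintegral_map hf (by fun_prop), lintegral_norm_sq_complexNormal hL hf, stdExp,
    lintegral_withDensity_eq_lintegral_mul _ (by fun_prop) hf]
  rfl

instance : IsProbabilityMeasure stdExp :=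
  map_norm_sq_complexNormal one_pos ▸ Measure.isProbabilityMeasure_map (by fun_prop)

theorem integral_stdExp (f : ℝ → ℝ) :
    ∫ t, f t ∂stdExp = ∫ t in Set.Ioi 0, Real.exp (-t) * f t := by
  unfold stdExp
  rw [integral_withDensity_eq_integral_toReal_smul (by fun_prop) (by simp)]
  simp [ENNReal.toReal_ofReal, Real.exp_nonneg]

theorem integrable_stdExp_iff (f : ℝ → ℝ) :
    Integrable f stdExp ↔ IntegrableOn (fun t => Real.exp (-t) * f t) (Set.Ioi 0) := by
  unfold stdExp IntegrableOn
  rw [integrable_withDensity_iff_integrable_smul' (by fun_prop) (by simp)]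
  simp [ENNReal.toReal_ofReal, Real.exp_nonneg]

/-- Differentiating the Gamma integral at `s = 1` brings down a factor `log t`, and `Γ'(1) = -γ`. -/
theorem integral_log_stdExp : ∫ t, Real.log t ∂stdExp = -Real.eulerMascheroniConstant := by
  rw [integral_stdExp]
  have h1 := Complex.hasDerivAt_GammaIntegral (s := 1) (by norm_num)
  have h2 : HasDerivAt Complex.GammaIntegral (-Real.eulerMascheroniConstant) 1 := by
    refine Complex.hasDerivAt_Gamma_one.congr_of_eventuallyEq ?_
    have : {z : ℂ | 0 < z.re} ∈ nhds (1 : ℂ) :=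
      (isOpen_lt continuous_const Complex.continuous_re).mem_nhds (by simp)
    filter_upwards [this] with z hz using (Complex.Gamma_eq_integral hz).symm
  have h3 := h1.unique h2
  have h4 : ∀ t : ℝ, (t : ℂ) ^ ((1 : ℂ) - 1) * (Real.log t * Real.exp (-t))
      = ((Real.exp (-t) * Real.log t : ℝ) : ℂ) := by
    intro t
    simp [mul_comm]
  simp_rw [h4] at h3
  rw [integral_complex_ofReal] at h3
  exact_mod_cast h3

theorem integrable_log_stdExp : Integrable Real.log stdExp := by
  -- A non-integrable function has Bochner integral `0` by convention, whereas this integral is `-γ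
  -- ≠ 0`.
  refine Integrable.of_integral_ne_zero ?_
  rw [integral_log_stdExp]
  have := Real.one_half_lt_eulerMascheroniConstant
  linarith

theorem integrable_id_stdExp : Integrable (fun t => t) stdExp := by
  rw [integrable_stdExp_iff]
  have := Real.GammaIntegral_convergent (s := 2) two_pos
  refine this.congr_fun (fun t ht => ?_) measurableSet_Ioi
  norm_num

theorem integral_id_stdExp : ∫ t, t ∂stdExp = 1 := by
  rw [integral_stdExp]
  have := Real.Gamma_eq_integral (s := 2) two_pos
  rw [Real.Gamma_two] at this
  rw [this]
  norm_num

/-- This is the convergence of the integral for `Γ(1/2)`. It makes `‖z‖⁻¹` integrable for a complex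
Gaussian, the source of all inverse moments below. -/
theorem lintegral_inv_sqrt_stdExp_lt_top :
    ∫⁻ t, ENNReal.ofReal ((√ t)⁻¹) ∂stdExp < ⊤ := by
  have h : Integrable (fun t : ℝ => (√ t)⁻¹) stdExp := by
    rw [integrable_stdExp_iff]
    have := Real.GammaIntegral_convergent (s := 1 / 2) (by norm_num)
    refine this.congr_fun (fun t ht => ?_) measurableSet_Ioi
    have ht : 0 < t := ht
    rw [Real.sqrt_eq_rpow, ← Real.rpow_neg ht.le]
    norm_num
  exact h.lintegral_lt_top

theorem integrable_log_norm_sq_complexNormal {L : ℝ} (hL : 0 < L) :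
    Integrable (fun z : ℂ => Real.log (‖z‖ ^ 2 / L)) (complexNormal L) := by
  have := integrable_log_stdExp
  rw [← map_norm_sq_complexNormal hL, integrable_map_measure
    (Measurable.aestronglyMeasurable (by fun_prop)) (by fun_prop)] at this
  exact this

theorem integral_log_norm_sq_complexNormal {L : ℝ} (hL : 0 < L) :
    ∫ z, Real.log (‖z‖ ^ 2 / L) ∂(complexNormal L) = -Real.eulerMascheroniConstant := by
  rw [← integral_log_stdExp, ← map_norm_sq_complexNormal hL, integral_map (by fun_prop)
    (Measurable.aestronglyMeasurable (by fun_prop))]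

theorem integrable_norm_sq_complexNormal {L : ℝ} (hL : 0 < L) :
    Integrable (fun z : ℂ => ‖z‖ ^ 2) (complexNormal L) := by
  have := integrable_id_stdExp
  rw [← map_norm_sq_complexNormal hL, integrable_map_measure
    (Measurable.aestronglyMeasurable (by fun_prop)) (by fun_prop)] at this
  refine (this.const_mul L).congr (Filter.Eventually.of_forall fun z => ?_)
  simp only [Function.comp_apply]
  field_simp

theorem integral_norm_sq_complexNormal {L : ℝ} (hL : 0 < L) :
    ∫ z, ‖z‖ ^ 2 ∂(complexNormal L) = L := by
  have := integral_id_stdExp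
  rw [← map_norm_sq_complexNormal hL, integral_map (by fun_prop)
    (Measurable.aestronglyMeasurable (by fun_prop)), integral_div] at this
  field_simp at this
  exact this

theorem ae_ne_zero_complexNormal {L : ℝ} (hL : 0 < L) : ∀ᵐ z ∂(complexNormal L), z ≠ 0 := by
  rw [complexNormal_eq_withDensity hL]
  exact (withDensity_absolutelyContinuous _ _).ae_le (compl_mem_ae_iff.2 (measure_singleton 0))

theorem lintegral_inv_norm_complexNormal_lt_top {L : ℝ} (hL : 0 < L) :
    ∫⁻ z, ‖z‖ₑ⁻¹ ∂(complexNormal L) < ⊤ := by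
  have h := lintegral_inv_sqrt_stdExp_lt_top
  rw [← map_norm_sq_complexNormal hL, lintegral_map (by fun_prop) (by fun_prop)] at h
  have h2 : ∫⁻ z, ENNReal.ofReal (√ L) * ‖z‖ₑ⁻¹ ∂(complexNormal L) < ⊤ := by
    refine lt_of_le_of_lt (le_of_eq ?_) h
    refine lintegral_congr_ae ?_
    filter_upwards [ae_ne_zero_complexNormal hL] with z hz
    have hz' : 0 < ‖z‖ := norm_pos_iff.2 hz
    rw [Real.sqrt_div (by positivity), Real.sqrt_sq hz'.le, inv_div, div_eq_mul_inv,
      ENNReal.ofReal_mul (by positivity), ENNReal.ofReal_inv_of_pos hz', ofReal_norm]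
  rw [lintegral_const_mul _ (by fun_prop)] at h2
  by_contra h3
  rw [not_lt, top_le_iff] at h3
  rw [h3, ENNReal.mul_top (by simpa using hL)] at h2
  exact lt_irrefl _ h2

/-- By independence the characteristic function factors, and the Gaussian exponents add up. -/
theorem map_sum_mul_complexNormal {ι : Type*} [Fintype ι] {L : ι → ℝ} (hL : ∀ i, 0 ≤ L i)
    (c : ι → ℂ) :
    (Measure.pi fun i => complexNormal (L i)).map (fun z => ∑ i, c i * z i)
      = complexNormal (∑ i, ‖c i‖ ^ 2 * L i) := by
  have hm : Measurable fun z : ι → ℂ => ∑ i, c i * z i :=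
    Continuous.measurable (by fun_prop)
  have : IsProbabilityMeasure
    ((Measure.pi fun i => complexNormal (L i)).map (fun z => ∑ i, c i * z i)) :=
    Measure.isProbabilityMeasure_map hm.aemeasurable
  refine Measure.ext_of_charFun (funext fun t => ?_)
  rw [charFun_complexNormal (Finset.sum_nonneg fun i _ => mul_nonneg (sq_nonneg _) (hL i)),
    charFun_apply, integral_map hm.aemeasurable
    (Measurable.aestronglyMeasurable (by fun_prop))]
  have h : ∀ z : ι → ℂ, Complex.exp (inner ℝ (∑ i, c i * z i) t * Complex.I)
      = ∏ i, Complex.exp (inner ℝ (z i) (star (c i) * t) * Complex.I) := by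
    intro z
    rw [← Complex.exp_sum, sum_inner]
    push_cast
    rw [Finset.sum_mul]
    congr 1
    refine Finset.sum_congr rfl fun i _ => ?_
    congr 2
    simp [Complex.inner]
    ring
  simp_rw [h]
  rw [integral_fintype_prod_eq_prod
    (f := fun i (z : ℂ) => Complex.exp (inner ℝ z (star (c i) * t) * Complex.I))]
  simp_rw [← charFun_apply, charFun_complexNormal (hL _), ← Complex.exp_sum]
  congr 1
  push_cast
  rw [Finset.sum_mul, Finset.sum_div, ← Finset.sum_neg_distrib]
  refine Finset.sum_congr rfl fun i _ => ?_
  simp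
  ring

theorem map_star_complexNormal {L : ℝ} (hL : 0 ≤ L) :
    (complexNormal L).map star = complexNormal L := by
  have : IsProbabilityMeasure ((complexNormal L).map star) :=
    Measure.isProbabilityMeasure_map (by fun_prop)
  refine Measure.ext_of_charFun (funext fun t => ?_)
  rw [charFun_apply, integral_map (by fun_prop)
    (Measurable.aestronglyMeasurable (by fun_prop))]
  have h : ∀ z : ℂ, inner ℝ (star z) t = inner ℝ z (star t) := by
    intro z; simp [Complex.inner]
  simp_rw [h]
  rw [← charFun_apply, charFun_complexNormal hL, charFun_complexNormal hL]
  simp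

theorem map_mul_complexNormal {L : ℝ} (hL : 0 ≤ L) (c : ℂ) :
    (complexNormal L).map (c * ·) = complexNormal (‖c‖ ^ 2 * L) := by
  have h := map_sum_mul_complexNormal (ι := Unit) (L := fun _ => L) (fun _ => hL) (fun _ => c)
  simp only [Finset.univ_unique, Finset.sum_singleton] at h
  conv_lhs => rw [← (measurePreserving_eval (fun _ : Unit => complexNormal L) ()).map_eq]
  rw [← h, Measure.map_map (by fun_prop) (by fun_prop)]
  rfl

theorem map_star_iidRayleigh (n : ℕ) {L : ℝ} (hL : 0 ≤ L) :
    (iidRayleigh n L).map star = iidRayleigh n L := by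
  have h := Measure.pi_map_pi (μ := fun _ : Fin n => complexNormal L) (f := fun _ => star)
    (fun _ => by fun_prop)
  simp only [map_star_complexNormal hL] at h
  exact h

end ComplexNormal

/-! ### Quadratic forms of inverse Gram matrices. -/

section GramForm

variable {m n : Type*} [Fintype m] [Fintype n]

theorem star_dotProduct_self (x : m → ℂ) : star x ⬝ᵥ x = ((∑ i, ‖x i‖ ^ 2 : ℝ) : ℂ) := by
  simp [dotProduct, ← Complex.normSq_eq_norm_sq, Complex.normSq_eq_conj_mul_self]

theorem sq_norm_star_dotProduct_le (x y : m → ℂ) :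
    ‖star x ⬝ᵥ y‖ ^ 2 ≤ (∑ i, ‖x i‖ ^ 2) * ∑ i, ‖y i‖ ^ 2 := by
  have h := norm_inner_le_norm (𝕜 := ℂ) (WithLp.toLp 2 x) (WithLp.toLp 2 y)
  have h2 : inner ℂ (WithLp.toLp 2 x) (WithLp.toLp 2 y) = star x ⬝ᵥ y := by
    simp [PiLp.inner_apply, dotProduct, mul_comm]
  rw [h2] at h
  have h3 := pow_le_pow_left₀ (norm_nonneg _) h 2
  rw [mul_pow, EuclideanSpace.norm_sq_eq, EuclideanSpace.norm_sq_eq] at h3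
  exact h3

theorem star_dotProduct_gram_mulVec (A : Matrix m n ℂ) (x y : n → ℂ) :
    star x ⬝ᵥ ((Aᴴ * A) *ᵥ y) = star (A *ᵥ x) ⬝ᵥ (A *ᵥ y) := by
  rw [Matrix.star_mulVec, ← Matrix.mulVec_mulVec, Matrix.dotProduct_mulVec]

theorem re_star_dotProduct_gram_mulVec_self (A : Matrix m n ℂ) (x : n → ℂ) :
    (star x ⬝ᵥ ((Aᴴ * A) *ᵥ x)).re = ∑ i, ‖(A *ᵥ x) i‖ ^ 2 := by
  rw [star_dotProduct_gram_mulVec, star_dotProduct_self, Complex.ofReal_re]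

variable [DecidableEq n]

theorem gram_mulVec_inv_mulVec {A : Matrix m n ℂ} (hA : (Aᴴ * A).det ≠ 0) (v : n → ℂ) :
    (Aᴴ * A) *ᵥ ((Aᴴ * A)⁻¹ *ᵥ v) = v := by
  rw [Matrix.mulVec_mulVec, Matrix.mul_nonsing_inv _ (isUnit_iff_ne_zero.2 hA), Matrix.one_mulVec]

theorem re_star_dotProduct_gram_inv {A : Matrix m n ℂ} (hA : (Aᴴ * A).det ≠ 0) (v : n → ℂ) :
    (star v ⬝ᵥ ((Aᴴ * A)⁻¹ *ᵥ v)).re = ∑ i, ‖(A *ᵥ ((Aᴴ * A)⁻¹ *ᵥ v)) i‖ ^ 2 := by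
  rw [← re_star_dotProduct_gram_mulVec_self, gram_mulVec_inv_mulVec hA]
  rw [← Complex.conj_re, ← starRingEnd_apply, starRingEnd_apply, starRingEnd_apply,
    Matrix.star_dotProduct, dotProduct_comm]
  simp

/-- With `y = (Aᴴ * A)⁻¹ v` one has `x^H v = (A x)^H (A y)`, and `‖A y‖^2` is the inverse form; this
is Cauchy–Schwarz. -/
theorem sq_norm_star_dotProduct_le_gram {A : Matrix m n ℂ} (hA : (Aᴴ * A).det ≠ 0)
    (x v : n → ℂ) : ‖star x ⬝ᵥ v‖ ^ 2
      ≤ (∑ i, ‖(A *ᵥ x) i‖ ^ 2) * (star v ⬝ᵥ ((Aᴴ * A)⁻¹ *ᵥ v)).re := by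
  rw [re_star_dotProduct_gram_inv hA]
  refine le_trans (le_of_eq ?_) (sq_norm_star_dotProduct_le _ _)
  rw [← star_dotProduct_gram_mulVec, gram_mulVec_inv_mulVec hA]

/-- The inverse form is the least squared norm of a solution `z` of `Aᴴ z = v`, so any explicit
solution bounds it from above. Keeping the scalar `δ` allows Cramer's rule without division. -/
theorem gram_inv_form_mul_le {A : Matrix m n ℂ} (hA : (Aᴴ * A).det ≠ 0) {v : n → ℂ} {z : m → ℂ}
    {δ : ℂ} (h : Aᴴ *ᵥ z = δ • v) :
    ‖δ‖ ^ 2 * (star v ⬝ᵥ ((Aᴴ * A)⁻¹ *ᵥ v)).re ≤ ∑ i, ‖z i‖ ^ 2 := by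
  set y := (Aᴴ * A)⁻¹ *ᵥ v with hy
  set S := ∑ i, ‖(A *ᵥ y) i‖ ^ 2 with hS
  have h1 : star y ⬝ᵥ v = (S : ℂ) := by
    rw [hS, ← star_dotProduct_self, ← star_dotProduct_gram_mulVec, hy, gram_mulVec_inv_mulVec hA]
  have h2 : star (A *ᵥ y) ⬝ᵥ z = δ * S := by
    rw [Matrix.star_mulVec, ← Matrix.dotProduct_mulVec, h, dotProduct_smul, h1, smul_eq_mul]
  have h3 := sq_norm_star_dotProduct_le (A *ᵥ y) z
  rw [re_star_dotProduct_gram_inv hA, ← hy, ← hS]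
  rw [h2, ← hS, norm_mul, mul_pow, Complex.norm_real, Real.norm_eq_abs, sq_abs] at h3
  have hS0 : 0 ≤ S := by positivity
  rcases hS0.eq_or_lt with h0 | h0
  · rw [← h0, mul_zero]; positivity
  · refine le_of_mul_le_mul_left ?_ h0
    linarith

/-- A kernel vector of the Gram matrix is killed by `A`, hence by `Qᴴ * A = (Aᴴ * Q)ᴴ`. -/
theorem gram_det_ne_zero {A : Matrix m n ℂ} {Q : Matrix m n ℂ} (h : (Aᴴ * Q).det ≠ 0) :
    (Aᴴ * A).det ≠ 0 := by
  intro h0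
  obtain ⟨x, hx, hx0⟩ := Matrix.exists_mulVec_eq_zero_iff.2 h0
  have h1 := re_star_dotProduct_gram_mulVec_self A x
  rw [hx0, dotProduct_zero, Complex.zero_re, eq_comm,
    Finset.sum_eq_zero_iff_of_nonneg (fun _ _ => by positivity)] at h1
  have h2 : A *ᵥ x = 0 := funext fun i => by simpa using h1 i (Finset.mem_univ _)
  have h3 : (Aᴴ * Q)ᴴ *ᵥ x = 0 := by
    rw [Matrix.conjTranspose_mul, Matrix.conjTranspose_conjTranspose, ← Matrix.mulVec_mulVec, h2,
      Matrix.mulVec_zero]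
  have h4 := Matrix.exists_mulVec_eq_zero_iff.1 ⟨x, hx, h3⟩
  rw [Matrix.det_conjTranspose, star_eq_zero] at h4
  exact h h4

end GramForm

/-! ### The projector orthogonal to `b`. -/

section Projection

variable {NB : ℕ} {b : Fin NB → ℂ}

theorem conjTranspose_projOrth (b : Fin NB → ℂ) : (projOrth b)ᴴ = projOrth b := by
  ext i j
  simp [projOrth, Matrix.vecMulVec, Matrix.one_apply, mul_comm, eq_comm]

theorem projOrth_mulVec (b y : Fin NB → ℂ) : projOrth b *ᵥ y = y - (star b ⬝ᵥ y) • b := by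
  rw [projOrth, Matrix.sub_mulVec, Matrix.one_mulVec, Matrix.vecMulVec_mulVec]
  ext i; simp [mul_comm]

theorem projOrth_mul_self (hb : ∑ i, ‖b i‖ ^ 2 = 1) : projOrth b * projOrth b = projOrth b := by
  have h : star b ⬝ᵥ b = 1 := by rw [star_dotProduct_self, hb, Complex.ofReal_one]
  rw [projOrth, mul_sub, sub_mul, sub_mul, Matrix.vecMulVec_mul_vecMulVec, h]
  simp

theorem sum_sq_norm_projOrth_mulVec_le (hb : ∑ i, ‖b i‖ ^ 2 = 1) (y : Fin NB → ℂ) :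
    ∑ i, ‖(projOrth b *ᵥ y) i‖ ^ 2 ≤ ∑ i, ‖y i‖ ^ 2 := by
  have h1 : ∑ i, ‖(projOrth b *ᵥ y) i‖ ^ 2 = (star y ⬝ᵥ (projOrth b *ᵥ y)).re := by
    rw [← re_star_dotProduct_gram_mulVec_self, conjTranspose_projOrth, projOrth_mul_self hb]
  have h2 : star y ⬝ᵥ b = star (star b ⬝ᵥ y) := Matrix.star_dotProduct y b
  rw [h1, projOrth_mulVec, dotProduct_sub, star_dotProduct_self, dotProduct_smul, smul_eq_mul, h2,
    Complex.star_def, Complex.mul_conj, Complex.sub_re, Complex.ofReal_re, Complex.ofReal_re]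
  linarith [Complex.normSq_nonneg (star b ⬝ᵥ y)]

end Projection

/-! ### The form of `C_s⁻¹`: positivity, measurability and a bound by Cramer's rule. -/

section Strong

variable {K NB NR : ℕ} {b : Fin NB → ℂ}

/-- The quadratic form of the inverse Gram matrix `C_s`. -/
def strongForm (b : Fin NB → ℂ) (hd : Fin K → Fin NB → ℂ) (v : Fin K → ℂ) : ℝ :=
  (star v ⬝ᵥ ((gramStrong b hd)⁻¹ *ᵥ v)).re

theorem mitigation_eq (LG : ℝ) (a : Fin NR → ℂ) (b : Fin NB → ℂ) (hd : Fin K → Fin NB → ℂ)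
    (hr : Fin (K + 1) → Fin NR → ℂ) (θ : Fin NR → ℂ) :
    mitigation LG a b hd hr θ = strongForm b hd
      ((fun k => cascadedRow NB LG a (hr k.castSucc) ⬝ᵥ θ) + directStrong hd *ᵥ b) := by
  have h : Dstrong LG a b hd hr *ᵥ thetaBar θ
      = (fun k => cascadedRow NB LG a (hr k.castSucc) ⬝ᵥ θ) + directStrong hd *ᵥ b := by
    rw [Dstrong, thetaBar, Matrix.fromCols_mulVec]
    ext k
    simp [cascadedStrong, Matrix.mulVec, Matrix.replicateCol, dotProduct]
  rw [mitigation, strongForm, ← h, Matrix.star_mulVec, ← Matrix.mulVec_mulVec,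
    ← Matrix.mulVec_mulVec, Matrix.dotProduct_mulVec]

/-- The projector is self-adjoint and idempotent, which puts `C_s` in the form `Aᴴ * A` required by
the Gram lemmas. -/
theorem gramStrong_eq (hb : ∑ i, ‖b i‖ ^ 2 = 1) (hd : Fin K → Fin NB → ℂ) :
    gramStrong b hd = ((directStrong hd * projOrth b)ᴴ)ᴴ * (directStrong hd * projOrth b)ᴴ := by
  rw [Matrix.conjTranspose_conjTranspose, Matrix.conjTranspose_mul, conjTranspose_projOrth,
    Matrix.mul_assoc, ← Matrix.mul_assoc (projOrth b), projOrth_mul_self hb, gramStrong,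
    Matrix.mul_assoc]

open scoped ComplexOrder in
theorem strongForm_nonneg (hb : ∑ i, ‖b i‖ ^ 2 = 1) (hd : Fin K → Fin NB → ℂ) (v : Fin K → ℂ) :
    0 ≤ strongForm b hd v := by
  have h : (gramStrong b hd)⁻¹.PosSemidef := by
    rw [gramStrong_eq hb]
    exact (Matrix.posSemidef_conjTranspose_mul_self _).inv
  exact (Complex.le_def.1 (h.dotProduct_mulVec_nonneg v)).1

theorem gramStrong_det_ne_zero (hb : ∑ i, ‖b i‖ ^ 2 = 1) {Q : Matrix (Fin NB) (Fin K) ℂ}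
    (hQ : projOrth b * Q = Q) {hd : Fin K → Fin NB → ℂ} (h : (directStrong hd * Q).det ≠ 0) :
    (gramStrong b hd).det ≠ 0 := by
  rw [gramStrong_eq hb]
  refine gram_det_ne_zero (Q := Q) ?_
  rwa [Matrix.conjTranspose_conjTranspose, Matrix.mul_assoc, hQ]

theorem sq_norm_le_mul_strongForm (hb : ∑ i, ‖b i‖ ^ 2 = 1) {hd : Fin K → Fin NB → ℂ}
    (h : (gramStrong b hd).det ≠ 0) (x v : Fin K → ℂ) :
    ‖star x ⬝ᵥ v‖ ^ 2
      ≤ (∑ i, ‖((directStrong hd * projOrth b)ᴴ *ᵥ x) i‖ ^ 2) * strongForm b hd v := by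
  rw [strongForm]
  rw [gramStrong_eq hb] at h ⊢
  exact sq_norm_star_dotProduct_le_gram h x v

/-- The vector `z = Q (cramer (H_d Q) v)` solves `H_d P z = det (H_d Q) • v`, since `P Q = Q`. -/
theorem sq_norm_det_mul_strongForm_le (hb : ∑ i, ‖b i‖ ^ 2 = 1) {Q : Matrix (Fin NB) (Fin K) ℂ}
    (hQ : projOrth b * Q = Q) {hd : Fin K → Fin NB → ℂ} (h : (directStrong hd * Q).det ≠ 0)
    (v : Fin K → ℂ) : ‖(directStrong hd * Q).det‖ ^ 2 * strongForm b hd v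
      ≤ ∑ i, ‖(Q *ᵥ Matrix.cramer (directStrong hd * Q) v) i‖ ^ 2 := by
  have h' := gramStrong_det_ne_zero hb hQ h
  rw [strongForm]
  rw [gramStrong_eq hb] at h' ⊢
  refine gram_inv_form_mul_le h' ?_
  rw [Matrix.conjTranspose_conjTranspose, Matrix.mulVec_mulVec, Matrix.mul_assoc, hQ,
    Matrix.mulVec_cramer]

theorem continuous_strongForm (b : Fin NB → ℂ) (hd : Fin K → Fin NB → ℂ) :
    Continuous (strongForm b hd) := by
  unfold strongForm
  fun_prop

/-- The inverse equals `det⁻¹` times the adjugate; both the determinant and the adjugate form are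
continuous. -/
theorem measurable_strongForm (b : Fin NB → ℂ) :
    Measurable fun p : (Fin K → Fin NB → ℂ) × (Fin K → ℂ) => strongForm b p.1 p.2 := by
  have h1 : Measurable fun p : (Fin K → Fin NB → ℂ) => (gramStrong b p).det := by
    refine Continuous.measurable ?_
    unfold gramStrong directStrong
    fun_prop
  have h2 : Continuous fun p : (Fin K → Fin NB → ℂ) × (Fin K → ℂ) =>
      star p.2 ⬝ᵥ ((gramStrong b p.1).adjugate *ᵥ p.2) := by
    unfold gramStrong directStrong
    fun_prop
  have h3 : (fun p : (Fin K → Fin NB → ℂ) × (Fin K → ℂ) => strongForm b p.1 p.2)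
      = fun p => (((gramStrong b p.1).det)⁻¹ *
        (star p.2 ⬝ᵥ ((gramStrong b p.1).adjugate *ᵥ p.2))).re := by
    ext p
    rw [strongForm, Matrix.inv_def, Matrix.smul_mulVec, dotProduct_smul, Ring.inverse_eq_inv',
      smul_eq_mul]
  rw [h3]
  exact Complex.measurable_re.comp (((h1.comp measurable_fst).inv).mul h2.measurable)

theorem norm_det_le_of_forall_norm_le {n : ℕ} {A : Matrix (Fin n) (Fin n) ℂ} {x : ℝ}
    (h : ∀ i j, ‖A i j‖ ≤ x) : ‖A.det‖ ≤ n.factorial * x ^ n := by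
  have := Matrix.det_le (A := A) (abv := NormedField.toAbsoluteValue ℂ) (x := x) h
  rw [Fintype.card_fin, nsmul_eq_mul] at this
  exact this

theorem norm_directStrong_mulVec_le (hd : Fin K → Fin NB → ℂ) {u : Fin NB → ℂ} {q : ℝ}
    (hu : ∀ j, ‖u j‖ ≤ q) (k : Fin K) : ‖(directStrong hd *ᵥ u) k‖ ≤ NB * q * ‖hd‖ := by
  calc ‖(directStrong hd *ᵥ u) k‖ = ‖∑ j, star (hd k j) * u j‖ := rfl
    _ ≤ ∑ j, ‖star (hd k j) * u j‖ := norm_sum_le _ _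
    _ ≤ ∑ _j : Fin NB, ‖hd‖ * q := by
        refine Finset.sum_le_sum fun j _ => ?_
        rw [norm_mul, norm_star]
        have h1 : ‖hd k j‖ ≤ ‖hd‖ := (norm_le_pi_norm (hd k) j).trans (norm_le_pi_norm hd k)
        exact mul_le_mul h1 (hu j) (norm_nonneg _) (norm_nonneg _)
    _ = NB * q * ‖hd‖ := by simp; ring

/-- Each Cramer entry is a `K × K` determinant whose entries are at most `c * T`, where `T = 1 +
‖hd‖ + ‖w‖`. -/
theorem exists_sum_sq_norm_cramer_le (b : Fin NB → ℂ) (Q : Matrix (Fin NB) (Fin K) ℂ) :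
    ∃ C : ℝ, 0 ≤ C ∧ ∀ (hd : Fin K → Fin NB → ℂ) (w : Fin K → ℂ),
      ∑ i, ‖(Q *ᵥ Matrix.cramer (directStrong hd * Q) (w + directStrong hd *ᵥ b)) i‖ ^ 2
        ≤ C * (1 + ‖hd‖ + ‖w‖) ^ (2 * K) := by
  obtain ⟨q, hq0, hq⟩ : ∃ q : ℝ, 0 ≤ q ∧ ∀ i k, ‖Q i k‖ ≤ q :=
    ⟨∑ i, ∑ k, ‖Q i k‖, by positivity, fun i k =>
      (Finset.single_le_sum (f := fun k => ‖Q i k‖) (fun _ _ => norm_nonneg _)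
        (Finset.mem_univ k)).trans (Finset.single_le_sum (f := fun i => ∑ k, ‖Q i k‖)
          (fun _ _ => by positivity) (Finset.mem_univ i))⟩
  set c : ℝ := 1 + NB * q + NB * ‖b‖ with hc
  have hc0 : 0 ≤ c := by positivity
  refine ⟨NB * (K * (q * (K.factorial * c ^ K))) ^ 2, by positivity, fun hd w => ?_⟩
  set T := 1 + ‖hd‖ + ‖w‖ with hT
  have hT1 : ‖hd‖ ≤ T := by linarith [norm_nonneg w]
  have hT2 : ‖w‖ ≤ T := by linarith [norm_nonneg hd]
  have hT0 : 0 ≤ T := by positivity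
  have hG : ∀ k l, ‖(directStrong hd * Q) k l‖ ≤ c * T := by
    intro k l
    refine (norm_directStrong_mulVec_le hd (u := fun j => Q j l) (fun j => hq j l) k).trans ?_
    have := mul_nonneg (Nat.cast_nonneg (α := ℝ) NB) hq0
    exact mul_le_mul (by rw [hc]; have : 0 ≤ NB * ‖b‖ := by positivity
                         linarith) hT1 (norm_nonneg _) hc0
  have hv : ∀ k, ‖(w + directStrong hd *ᵥ b) k‖ ≤ c * T := by
    intro k
    have h1 := norm_directStrong_mulVec_le hd (u := b) (norm_le_pi_norm b) k
    have h2 : NB * ‖b‖ * ‖hd‖ ≤ NB * ‖b‖ * T := by gcongr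
    have h3 : 0 ≤ NB * q * T := by positivity
    have h4 := norm_le_pi_norm w k
    refine (norm_add_le _ _).trans ?_
    rw [hc]
    nlinarith
  have hcr : ∀ k, ‖Matrix.cramer (directStrong hd * Q) (w + directStrong hd *ᵥ b) k‖
      ≤ K.factorial * (c * T) ^ K := by
    intro k
    rw [Matrix.cramer_apply]
    refine norm_det_le_of_forall_norm_le fun i j => ?_
    rw [Matrix.updateCol_apply]
    split_ifs
    · exact hv i
    · exact hG i j
  have hz : ∀ i, ‖(Q *ᵥ Matrix.cramer (directStrong hd * Q) (w + directStrong hd *ᵥ b)) i‖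
      ≤ K * (q * (K.factorial * (c * T) ^ K)) := by
    intro i
    rw [Matrix.mulVec, dotProduct]
    refine (norm_sum_le _ _).trans ?_
    refine (Finset.sum_le_sum (g := fun _ => q * (K.factorial * (c * T) ^ K))
      fun k _ => ?_).trans (by simp)
    rw [norm_mul]
    exact mul_le_mul (hq i k) (hcr k) (norm_nonneg _) hq0
  refine (Finset.sum_le_sum (g := fun _ => (K * (q * (K.factorial * (c * T) ^ K))) ^ 2)
    fun i _ => pow_le_pow_left₀ (norm_nonneg _) (hz i) 2).trans (le_of_eq ?_)
  simp only [Finset.sum_const, Finset.card_univ, Fintype.card_fin, nsmul_eq_mul]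
  ring_nf

theorem exists_projOrth_frame (hb : ∑ i, ‖b i‖ ^ 2 = 1) (hK : K + 1 ≤ NB) :
    ∃ (Q : Matrix (Fin NB) (Fin K) ℂ) (e : Fin K → Fin NB), projOrth b * Q = Q ∧
      (directStrong (fun k => Pi.single (e k) 1) * Q).det ≠ 0 := by
  obtain ⟨i₀, hi₀⟩ : ∃ i, b i ≠ 0 := by
    by_contra! h
    simp [h] at hb
  obtain ⟨N, rfl⟩ : ∃ N, NB = N + 1 := ⟨NB - 1, by omega⟩
  have hinj : Function.Injective fun k : Fin K => i₀.succAbove (Fin.castLE (by omega) k) :=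
    Fin.succAbove_right_injective.comp (Fin.castLE_injective _)
  set e : Fin K → Fin (N + 1) := fun k => i₀.succAbove (Fin.castLE (by omega) k) with he
  have hne : ∀ k, e k ≠ i₀ := fun k => Fin.succAbove_ne _ _
  -- A unit vector off the coordinate `i₀`, corrected along `i₀` to be orthogonal to `b`. The
  -- coordinates `e k` avoid `i₀`, so the correction does not show in the rows `e k` and the product
  -- below is the identity.
  let q : Fin K → Fin (N + 1) → ℂ := fun k =>
    Pi.single (e k) 1 - (star (b (e k)) / star (b i₀)) • Pi.single i₀ 1
  refine ⟨Matrix.of fun i k => q k i, e, ?_, ?_⟩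
  · have hq : ∀ k, projOrth b *ᵥ q k = q k := by
      intro k
      have : star b ⬝ᵥ q k = 0 := by
        have : star (b i₀) ≠ 0 := star_ne_zero.2 hi₀
        simp only [q, dotProduct_sub, dotProduct_smul, dotProduct_single, Pi.star_apply, mul_one,
          smul_eq_mul]
        field_simp
        simp
      rw [projOrth_mulVec, this, zero_smul, sub_zero]
    ext i k
    exact congrFun (hq k) i
  · have : directStrong (fun k => Pi.single (e k) 1) * (Matrix.of fun i k => q k i)
        = (1 : Matrix (Fin K) (Fin K) ℂ) := by
      ext k l
      have h1 : star (Pi.single (e k) (1 : ℂ) : Fin (N + 1) → ℂ) = Pi.single (e k) 1 := by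
        ext j
        simp only [Pi.star_apply, Pi.single_apply]
        split_ifs <;> simp
      simp only [Matrix.mul_apply', directStrong]
      change star (Pi.single (e k) (1 : ℂ) : Fin (N + 1) → ℂ) ⬝ᵥ q l = _
      rw [h1, single_dotProduct, one_mul]
      simp only [q, Pi.sub_apply, Pi.smul_apply, Pi.single_apply, hne, if_false, smul_zero, sub_zero,
        Matrix.one_apply, hinj.eq_iff]
    rw [this]; simp

end Strong

/-! ### Inverse first moments of multilinear functions of Gaussian vectors. -/

section InverseMoment

theorem map_linearMap_iidRayleigh {n : ℕ} {L : ℝ} (hL : 0 ≤ L) (l : (Fin n → ℂ) →ₗ[ℂ] ℂ) :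
    (iidRayleigh n L).map l = complexNormal (∑ i, ‖l (Pi.single i 1)‖ ^ 2 * L) := by
  rw [← map_sum_mul_complexNormal (fun _ => hL)]
  congr 1
  ext h
  rw [LinearMap.pi_apply_eq_sum_univ l h]
  simp only [smul_eq_mul, mul_comm]
  refine Finset.sum_congr rfl fun i _ => ?_
  congr 2
  ext j
  simp [Pi.single_apply, eq_comm]

/-- The image of the law under `l` is a centred complex Gaussian scaled by `σ ≥ ‖l (Pi.single i
1)‖`. The summand `1` keeps the constant nonzero, so the right side is `⊤` when `l (Pi.single i 1) =
0` and no nondegeneracy is needed. -/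
theorem lintegral_inv_norm_linearMap_le {n : ℕ} {L : ℝ} (hL : 0 < L)
    (l : (Fin n → ℂ) →ₗ[ℂ] ℂ) (i : Fin n) :
    ∫⁻ h, ‖l h‖ₑ⁻¹ ∂(iidRayleigh n L)
      ≤ (1 + ∫⁻ z, ‖z‖ₑ⁻¹ ∂(complexNormal L)) * ‖l (Pi.single i 1)‖ₑ⁻¹ := by
  by_cases hi : l (Pi.single i 1) = 0
  · simp [hi]
  have hlm : Measurable l := (LinearMap.continuous_of_finiteDimensional l).measurable
  set σ := √ (∑ i, ‖l (Pi.single i 1)‖ ^ 2) with hσ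
  have hle : ‖l (Pi.single i 1)‖ ≤ σ := by
    refine Real.le_sqrt_of_sq_le ?_
    exact Finset.single_le_sum (f := fun i => ‖l (Pi.single i 1)‖ ^ 2) (fun _ _ => by positivity)
      (Finset.mem_univ i)
  have hσ0 : 0 < σ := (norm_pos_iff.2 hi).trans_le hle
  have h1 : (complexNormal L).map ((σ : ℂ) * ·) = (iidRayleigh n L).map l := by
    rw [map_mul_complexNormal hL.le, map_linearMap_iidRayleigh hL.le, Complex.norm_real,
      Real.norm_eq_abs, sq_abs, hσ, Real.sq_sqrt (by positivity), Finset.sum_mul]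
  have h2 : ∫⁻ h, ‖l h‖ₑ⁻¹ ∂(iidRayleigh n L) = ∫⁻ z, ‖(σ : ℂ) * z‖ₑ⁻¹ ∂(complexNormal L) := by
    rw [← lintegral_map (f := fun z : ℂ => ‖z‖ₑ⁻¹) (by fun_prop) hlm, ← h1,
      lintegral_map (by fun_prop) (by fun_prop)]
  rw [h2, mul_comm]
  have hne : ‖(σ : ℂ)‖ₑ ≠ 0 := by simpa using hσ0.ne'
  simp_rw [enorm_mul, ENNReal.mul_inv (Or.inl hne) (Or.inl enorm_ne_top)]
  rw [lintegral_const_mul _ (by fun_prop)]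
  refine mul_le_mul' ?_ le_add_self
  rw [ENNReal.inv_le_inv, ← ofReal_norm, ← ofReal_norm, Complex.norm_real, Real.norm_eq_abs,
    abs_of_pos hσ0]
  exact ENNReal.ofReal_le_ofReal hle

/-- Induction on the number of arguments: with the others fixed, `f` is linear in the first, and
integrating that one out replaces it by a unit vector at the cost of a constant factor. -/
theorem lintegral_inv_norm_multilinearMap_le {n : ℕ} : ∀ {K : ℕ}
    (f : MultilinearMap ℂ (fun _ : Fin K => Fin n → ℂ) ℂ) (_ : Continuous f) (e : Fin K → Fin n)
    {L : Fin K → ℝ} (_ : ∀ k, 0 < L k),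
    ∫⁻ h, ‖f h‖ₑ⁻¹ ∂(Measure.pi fun k => iidRayleigh n (L k))
      ≤ (∏ k, (1 + ∫⁻ z, ‖z‖ₑ⁻¹ ∂(complexNormal (L k))))
        * ‖f fun k => Pi.single (e k) 1‖ₑ⁻¹ := by
  intro K
  induction K with
  | zero =>
    intro f hf e L _
    have : ∀ h : Fin 0 → Fin n → ℂ, f h = f fun k => Pi.single (e k) 1 :=
      fun h => congrArg f (Subsingleton.elim _ _)
    simp_rw [this]
    simp
  | succ K ih =>
    intro f hf e L hL
    have hfm : Measurable f := hf.measurable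
    have hc : Continuous (f.curryLeft (Pi.single (e 0) 1)) := by
      change Continuous fun h : Fin K → Fin n → ℂ => f (Fin.cons (Pi.single (e 0) 1) h)
      exact hf.comp (continuous_const.finCons continuous_id)
    have hl : ∀ (x : Fin n → ℂ) (h : Fin K → Fin n → ℂ),
        f.toLinearMap (Fin.cons 0 h) 0 x = f (Fin.cons x h) := by
      intro x h
      rw [MultilinearMap.toLinearMap_apply, Fin.update_cons_zero]
    have hmp := (measurePreserving_piFinSuccAbove (fun k => iidRayleigh n (L k)) 0).symm
    rw [← hmp.lintegral_comp (by fun_prop), lintegral_prod_symm _ (by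
      exact ((hfm.comp (MeasurableEquiv.measurable _)).enorm.inv).aemeasurable)]
    have hcons : ∀ (x : Fin n → ℂ) (h : Fin K → Fin n → ℂ),
        (MeasurableEquiv.piFinSuccAbove (fun _ : Fin (K + 1) => Fin n → ℂ) 0).symm (x, h)
          = Fin.cons x h := by
      intro x h
      simp [MeasurableEquiv.piFinSuccAbove, Fin.insertNthEquiv, Fin.insertNth_zero']
    simp only [hcons]
    calc _ ≤ ∫⁻ h : Fin K → Fin n → ℂ, (1 + ∫⁻ z, ‖z‖ₑ⁻¹ ∂(complexNormal (L 0)))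
            * ‖f (Fin.cons (Pi.single (e 0) 1) h)‖ₑ⁻¹
            ∂(Measure.pi fun k => iidRayleigh n (L (Fin.succAbove 0 k))) := by
          refine lintegral_mono fun h => ?_
          have := lintegral_inv_norm_linearMap_le (hL 0) (f.toLinearMap (Fin.cons 0 h) 0) (e 0)
          simpa only [hl] using this
      _ ≤ _ := by
          rw [lintegral_const_mul]
          · rw [Fin.prod_univ_succ, mul_assoc]
            gcongr
            refine (ih (f.curryLeft (Pi.single (e 0) 1)) hc (fun k => e k.succ)
              (fun k => hL k.succ)).trans (le_of_eq ?_)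
            congr 3
            rw [MultilinearMap.curryLeft_apply]
            congr 1
            ext k
            refine Fin.cases ?_ (fun k => ?_) k <;> simp
          · exact hc.measurable.enorm.inv

end InverseMoment

/-! ### Jensen's formula on a circle. -/

section CircleAverage

open Real in
-- The circle average of `log ‖z - a‖` over radius `R` about `0` is `log R + log⁺ (‖a‖ / R) ≥ log
-- R`. Dividing by `√q` gives `R = s / √q`, and the integrand is then at most `log (1 + F) / 2`.
theorem two_mul_log_le_circle_integral {s q : ℝ} (hs : 0 < s) (hq : 0 < q) (g : ℂ) {F : ℝ → ℝ}
    (hF : Continuous F) (hF0 : ∀ t, 0 ≤ F t)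
    (h : ∀ t : ℝ, ‖Complex.exp (t * Complex.I) * s + g‖ ^ 2 ≤ q * F t) :
    2 * Real.log s - Real.log q ≤ (2 * π)⁻¹ * ∫ t in (0 : ℝ)..(2 * π), Real.log (1 + F t) := by
  have hR : s / √q ≠ 0 := by positivity
  have h1 := circleAverage_log_norm_sub_const_eq_log_radius_add_posLog (a := -g / √q) (c := 0) hR
  have h2 : Real.log (s / √q) ≤ circleAverage (fun x => Real.log ‖x - -g / √q‖) 0 (s / √q) := by
    rw [h1]; linarith [posLog_nonneg (x := (s / √q)⁻¹ * ‖0 - -g / √q‖)]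
  rw [Real.log_div hs.ne' (by positivity), Real.log_sqrt hq.le, circleAverage_def,
    smul_eq_mul] at h2
  have hci := circleIntegrable_log_norm_sub_const (a := -g / √q) (c := 0) (s / √q)
  have h3 : ∫ t in (0 : ℝ)..(2 * π), 2 * Real.log ‖circleMap 0 (s / √q) t - -g / √q‖
      ≤ ∫ t in (0 : ℝ)..(2 * π), Real.log (1 + F t) := by
    refine intervalIntegral.integral_mono_on (by positivity) (hci.const_mul 2) ?_ fun t _ => ?_
    · refine Continuous.intervalIntegrable ?_ _ _
      exact Continuous.log (f := fun t => 1 + F t) (by fun_prop) fun t => by linarith [hF0 t]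
    · set n := ‖circleMap 0 (s / √q) t - -g / √q‖ with hn
      have h4 : n ^ 2 ≤ F t := by
        have : circleMap 0 (s / √q) t - -g / √q = (Complex.exp (t * Complex.I) * s + g) / √q := by
          simp [circleMap]; ring
        rw [hn, this, norm_div, Complex.norm_real, div_pow, norm_eq_abs, sq_abs, sq_sqrt hq.le,
          div_le_iff₀ hq, mul_comm (F t)]
        exact h t
      -- At a zero of the affine function `log 0 = 0`, and the claim is only `0 ≤ log (1 + F t)`.
      rcases eq_or_ne n 0 with h0 | h0
      · rw [h0, log_zero, mul_zero]; exact log_nonneg (by linarith [hF0 t])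
      · have hnp : 0 < n := lt_of_le_of_ne (norm_nonneg _) (Ne.symm h0)
        have : 2 * log n = log (n ^ 2) := by rw [log_pow]; norm_num
        rw [this]
        exact log_le_log (by positivity) (by linarith)
  rw [intervalIntegral.integral_const_mul] at h3
  have h5 : 0 < (2 * π)⁻¹ := by positivity
  nlinarith [mul_le_mul_of_nonneg_left h3 h5.le]

end CircleAverage

/-! ### Integrability of the loss of the strong users. -/

section Integrability

theorem integrable_norm_complexNormal {L : ℝ} (hL : 0 < L) :
    Integrable (fun z : ℂ => ‖z‖) (complexNormal L) := by
  refine ((integrable_const 1).add (integrable_norm_sq_complexNormal hL)).mono'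
    (Measurable.aestronglyMeasurable (by fun_prop)) (Filter.Eventually.of_forall fun z => ?_)
  rw [norm_norm, Pi.add_apply]
  nlinarith [sq_nonneg (‖z‖ - 1), norm_nonneg z]

theorem integrable_norm_pi {ι E : Type*} [Fintype ι] [NormedAddCommGroup E] [MeasurableSpace E]
    [OpensMeasurableSpace E] [SecondCountableTopology E] {μ : ι → Measure E}
    [∀ i, IsProbabilityMeasure (μ i)] (h : ∀ i, Integrable (fun x => ‖x‖) (μ i)) :
    Integrable (fun x : ι → E => ‖x‖) (Measure.pi μ) := by
  have h1 : Integrable (fun x : ι → E => ∑ i, ‖x i‖) (Measure.pi μ) :=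
    integrable_finsetSum _ fun i _ => integrable_comp_eval (h i)
  refine h1.mono' (Measurable.aestronglyMeasurable (by fun_prop))
    (Filter.Eventually.of_forall fun x => ?_)
  rw [norm_norm]
  exact (pi_norm_le_iff_of_nonneg (by positivity)).2 fun i =>
    Finset.single_le_sum (f := fun i => ‖x i‖) (fun _ _ => norm_nonneg _) (Finset.mem_univ i)

theorem integrable_norm_iidRayleigh (n : ℕ) {L : ℝ} (hL : 0 < L) :
    Integrable (fun h => ‖h‖) (iidRayleigh n L) :=
  integrable_norm_pi fun _ => integrable_norm_complexNormal hL

variable {K NB : ℕ} {b : Fin NB → ℂ} {Ld : Fin K → ℝ} {σ : Fin K → ℝ}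

theorem map_star_pi_iidRayleigh (hLd : ∀ k, 0 < Ld k) :
    (Measure.pi fun k => iidRayleigh NB (Ld k)).map star
      = Measure.pi fun k => iidRayleigh NB (Ld k) := by
  have h := Measure.pi_map_pi (μ := fun k => iidRayleigh NB (Ld k)) (f := fun _ => star)
    (hμ := fun k => by rw [map_star_iidRayleigh NB (hLd k).le]; infer_instance)
    (fun _ => by fun_prop)
  simp only [fun k => map_star_iidRayleigh NB (hLd k).le] at h
  exact h

/-- The determinant is multilinear in the rows of `H_d`. These are conjugated channels, with the
same law as the channels; nonvanishing at one choice of unit rows makes the bound finite. -/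
theorem lintegral_inv_norm_det_lt_top (hLd : ∀ k, 0 < Ld k) {Q : Matrix (Fin NB) (Fin K) ℂ}
    {e : Fin K → Fin NB} (he : (directStrong (fun k => Pi.single (e k) 1) * Q).det ≠ 0) :
    ∫⁻ hd, ‖(directStrong hd * Q).det‖ₑ⁻¹ ∂(Measure.pi fun k => iidRayleigh NB (Ld k)) < ⊤ := by
  let f : MultilinearMap ℂ (fun _ : Fin K => Fin NB → ℂ) ℂ :=
    (Matrix.detRowAlternating (n := Fin K) (R := ℂ)).toMultilinearMap.compLinearMap
      fun _ => Q.vecMulLinear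
  have hf : ∀ u : Fin K → Fin NB → ℂ, f u = (Matrix.of u * Q).det := fun u => rfl
  have hfc : Continuous f := by
    have : (f : (Fin K → Fin NB → ℂ) → ℂ) = fun u => (Matrix.of u * Q).det := funext hf
    rw [this]
    fun_prop
  have h1 := lintegral_inv_norm_multilinearMap_le f hfc e hLd
  have h2 : ∫⁻ hd, ‖(directStrong hd * Q).det‖ₑ⁻¹ ∂(Measure.pi fun k => iidRayleigh NB (Ld k))
      = ∫⁻ u, ‖f u‖ₑ⁻¹ ∂(Measure.pi fun k => iidRayleigh NB (Ld k)) := by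
    conv_rhs => rw [← map_star_pi_iidRayleigh hLd]
    rw [lintegral_map (by exact hfc.measurable.enorm.inv) (by fun_prop)]
    rfl
  rw [h2]
  refine h1.trans_lt (ENNReal.mul_lt_top (ENNReal.prod_lt_top fun k _ => ?_) ?_)
  · exact ENNReal.add_lt_top.2 ⟨ENNReal.one_lt_top, lintegral_inv_norm_complexNormal_lt_top (hLd k)⟩
  · rw [ENNReal.inv_lt_top, hf]
    have h3 : (Matrix.of fun k => (Pi.single (e k) 1 : Fin NB → ℂ))
        = directStrong (fun k => Pi.single (e k) 1) := by
      ext k j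
      by_cases hj : j = e k <;> simp [directStrong, hj]
    rw [h3]
    simpa using he

theorem measurable_det_directStrong_mul (Q : Matrix (Fin NB) (Fin K) ℂ) :
    Measurable fun hd : Fin K → Fin NB → ℂ => (directStrong hd * Q).det := by
  refine Continuous.measurable ?_
  unfold directStrong
  fun_prop

theorem ae_det_ne_zero (hLd : ∀ k, 0 < Ld k) {Q : Matrix (Fin NB) (Fin K) ℂ}
    {e : Fin K → Fin NB} (he : (directStrong (fun k => Pi.single (e k) 1) * Q).det ≠ 0) :
    ∀ᵐ hd ∂(Measure.pi fun k => iidRayleigh NB (Ld k)), (directStrong hd * Q).det ≠ 0 := by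
  filter_upwards [ae_lt_top (measurable_det_directStrong_mul Q).enorm.inv
    (lintegral_inv_norm_det_lt_top hLd he).ne] with hd h h0
  simp [h0] at h

theorem ae_gramStrong_det_ne_zero (hb : ∑ i, ‖b i‖ ^ 2 = 1) (hNB : K + 1 ≤ NB)
    (hLd : ∀ k, 0 < Ld k) :
    ∀ᵐ hd ∂(Measure.pi fun k => iidRayleigh NB (Ld k)), (gramStrong b hd).det ≠ 0 := by
  obtain ⟨Q, e, hQ, he⟩ := exists_projOrth_frame hb hNB
  filter_upwards [ae_det_ne_zero hLd he] with hd h using gramStrong_det_ne_zero hb hQ h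

theorem integrable_inv_norm_det (hLd : ∀ k, 0 < Ld k) {Q : Matrix (Fin NB) (Fin K) ℂ}
    {e : Fin K → Fin NB} (he : (directStrong (fun k => Pi.single (e k) 1) * Q).det ≠ 0) :
    Integrable (fun hd => ‖(directStrong hd * Q).det‖⁻¹)
      (Measure.pi fun k => iidRayleigh NB (Ld k)) := by
  refine ⟨(measurable_det_directStrong_mul Q).norm.inv.aestronglyMeasurable, ?_⟩
  refine lt_of_le_of_lt (le_of_eq ?_) (lintegral_inv_norm_det_lt_top hLd he)
  refine lintegral_congr_ae ?_
  filter_upwards [ae_det_ne_zero hLd he] with hd h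
  rw [enorm_inv (norm_ne_zero_iff.2 h), enorm_norm]

/-- The spectral efficiency loss of the strong users, as a function of their direct channels
and of their effective scalar cascaded channels. -/
def logLoss (b : Fin NB → ℂ) (p : (Fin K → Fin NB → ℂ) × (Fin K → ℂ)) : ℝ :=
  Real.log (1 + strongForm b p.1 (p.2 + directStrong p.1 *ᵥ b))

theorem measurable_logLoss (b : Fin NB → ℂ) :
    Measurable (logLoss b : (Fin K → Fin NB → ℂ) × (Fin K → ℂ) → ℝ) := by
  have h1 : Measurable fun p : (Fin K → Fin NB → ℂ) × (Fin K → ℂ) =>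
      p.2 + directStrong p.1 *ᵥ b := by
    refine Continuous.measurable ?_
    unfold directStrong
    fun_prop
  have h2 : Measurable fun p : (Fin K → Fin NB → ℂ) × (Fin K → ℂ) =>
      strongForm b p.1 (p.2 + directStrong p.1 *ᵥ b) := by
    have h3 := measurable_strongForm (K := K) b
    generalize strongForm b = F at h3 ⊢
    exact h3.comp (measurable_fst.prodMk h1)
  exact (h2.const_add 1).log

theorem logLoss_nonneg (hb : ∑ i, ‖b i‖ ^ 2 = 1) (p : (Fin K → Fin NB → ℂ) × (Fin K → ℂ)) :
    0 ≤ logLoss b p :=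
  Real.log_nonneg (by linarith [strongForm_nonneg hb p.1 (p.2 + directStrong p.1 *ᵥ b)])

/-- The hypothesis gives `1 + M ≤ (1 + C) * T ^ (2 * m) * (1 + d⁻¹) ^ 2`; taking logarithms and
using `log y ≤ y - 1` leaves terms linear in `T` and `d⁻¹`, for which first moments suffice. -/
theorem log_one_add_le_of_sq_mul_le {M d C T : ℝ} {m : ℕ} (hM : 0 ≤ M) (hd : 0 < d) (hC : 0 ≤ C)
    (hT : 1 ≤ T) (h : d ^ 2 * M ≤ C * T ^ (2 * m)) :
    Real.log (1 + M) ≤ Real.log (1 + C) + 2 * m * T + 2 * d⁻¹ := by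
  have hy : 0 < d⁻¹ := inv_pos.2 hd
  have h1 : M ≤ C * T ^ (2 * m) * d⁻¹ ^ 2 := by
    rw [inv_pow, ← div_eq_mul_inv, le_div_iff₀ (by positivity)]; linarith
  have hT' : 1 ≤ T ^ (2 * m) := one_le_pow₀ hT
  have h2 : 1 + M ≤ (1 + C) * T ^ (2 * m) * (1 + d⁻¹) ^ 2 := by
    have : 0 ≤ C * T ^ (2 * m) := by positivity
    nlinarith [mul_nonneg this hy.le, mul_nonneg (by linarith : 0 ≤ T ^ (2 * m)) hy.le,
      mul_nonneg (by linarith : 0 ≤ T ^ (2 * m)) (sq_nonneg d⁻¹)]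
  refine (Real.log_le_log (by linarith) h2).trans ?_
  rw [Real.log_mul (by positivity) (by positivity), Real.log_mul (by positivity) (by positivity),
    Real.log_pow, Real.log_pow]
  have h3 := Real.log_le_sub_one_of_pos (by linarith : 0 < T)
  have h4 := Real.log_le_sub_one_of_pos (by linarith : 0 < 1 + d⁻¹)
  have h5 : ((2 * m : ℕ) : ℝ) * Real.log T ≤ 2 * m * T := by
    push_cast; gcongr; linarith
  push_cast at h5 ⊢
  linarith

theorem integrable_logLoss (hb : ∑ i, ‖b i‖ ^ 2 = 1) (hNB : K + 1 ≤ NB) (hLd : ∀ k, 0 < Ld k)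
    (hσ : ∀ k, 0 < σ k) :
    Integrable (logLoss b) ((Measure.pi fun k => iidRayleigh NB (Ld k)).prod
      (Measure.pi fun k => complexNormal (σ k))) := by
  obtain ⟨Q, e, hQ, he⟩ := exists_projOrth_frame hb hNB
  obtain ⟨C, hC0, hC⟩ := exists_sum_sq_norm_cramer_le b Q
  set μd := Measure.pi fun k => iidRayleigh NB (Ld k)
  set ν := Measure.pi fun k => complexNormal (σ k)
  have hi1 : Integrable (fun p : (Fin K → Fin NB → ℂ) × (Fin K → ℂ) => ‖p.1‖) (μd.prod ν) :=
    (integrable_norm_pi fun k => integrable_norm_iidRayleigh NB (hLd k)).comp_fst ν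
  have hi2 : Integrable (fun p : (Fin K → Fin NB → ℂ) × (Fin K → ℂ) => ‖p.2‖) (μd.prod ν) :=
    (integrable_norm_pi fun k => integrable_norm_complexNormal (hσ k)).comp_snd μd
  have hi3 : Integrable (fun p : (Fin K → Fin NB → ℂ) × (Fin K → ℂ) =>
      ‖(directStrong p.1 * Q).det‖⁻¹) (μd.prod ν) :=
    (integrable_inv_norm_det hLd he).comp_fst ν
  have hbound : Integrable (fun p : (Fin K → Fin NB → ℂ) × (Fin K → ℂ) => Real.log (1 + C)
      + 2 * K * (1 + ‖p.1‖ + ‖p.2‖) + 2 * ‖(directStrong p.1 * Q).det‖⁻¹) (μd.prod ν) :=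
    ((integrable_const _).add ((((integrable_const 1).add hi1).add hi2).const_mul
      (2 * K : ℝ))).add (hi3.const_mul 2)
  refine hbound.mono' (measurable_logLoss b).aestronglyMeasurable ?_
  have hdet : ∀ᵐ p ∂(μd.prod ν), (directStrong p.1 * Q).det ≠ 0 :=
    Measure.quasiMeasurePreserving_fst.ae (ae_det_ne_zero hLd he)
  filter_upwards [hdet] with p hp
  rw [Real.norm_eq_abs, abs_of_nonneg (logLoss_nonneg hb p)]
  exact log_one_add_le_of_sq_mul_le (strongForm_nonneg hb _ _) (norm_pos_iff.2 hp) hC0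
    (by linarith [norm_nonneg p.1, norm_nonneg p.2])
    ((sq_norm_det_mul_strongForm_le hb hQ hp _).trans (hC p.1 p.2))

end Integrability

/-! ### Lower bound for the mean loss. -/

section LowerBound

variable {K NB : ℕ} {b : Fin NB → ℂ} {Ld : Fin K → ℝ} {σ : Fin K → ℝ}

theorem map_conjTranspose_directStrong_mulVec (hLd : ∀ k, 0 < Ld k) (x : Fin K → ℂ) (j : Fin NB) :
    (Measure.pi fun k => iidRayleigh NB (Ld k)).map (fun hd => ((directStrong hd)ᴴ *ᵥ x) j)
      = complexNormal (∑ k, ‖x k‖ ^ 2 * Ld k) := by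
  have h1 : (Measure.pi fun k => iidRayleigh NB (Ld k)).map (fun hd k => hd k j)
      = Measure.pi fun k => complexNormal (Ld k) := by
    have heval : ∀ k, (iidRayleigh NB (Ld k)).map (fun h => h j) = complexNormal (Ld k) :=
      fun k => (measurePreserving_eval (fun _ : Fin NB => complexNormal (Ld k)) j).map_eq
    have h := Measure.pi_map_pi (μ := fun k => iidRayleigh NB (Ld k))
      (f := fun _ (h : Fin NB → ℂ) => h j)
      (hμ := fun k => by rw [heval]; infer_instance)
      (fun _ => (measurable_pi_apply j).aemeasurable)
    simp only [heval] at h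
    exact h
  have hm : Measurable fun z : Fin K → ℂ => ∑ k, x k * z k := Continuous.measurable (by fun_prop)
  rw [← map_sum_mul_complexNormal (fun k => (hLd k).le), ← h1,
    Measure.map_map hm (by fun_prop)]
  congr 1
  ext hd
  simp [directStrong, Matrix.mulVec, dotProduct, mul_comm]

theorem integrable_sum_sq_norm_directStrong (hLd : ∀ k, 0 < Ld k) {x : Fin K → ℂ}
    (hx : 0 < ∑ k, ‖x k‖ ^ 2 * Ld k) :
    Integrable (fun hd => ∑ j, ‖((directStrong hd)ᴴ *ᵥ x) j‖ ^ 2)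
      (Measure.pi fun k => iidRayleigh NB (Ld k)) ∧
    ∫ hd, ∑ j, ‖((directStrong hd)ᴴ *ᵥ x) j‖ ^ 2 ∂(Measure.pi fun k => iidRayleigh NB (Ld k))
      = NB * ∑ k, ‖x k‖ ^ 2 * Ld k := by
  have hm : ∀ j, Measurable fun hd : Fin K → Fin NB → ℂ => ((directStrong hd)ᴴ *ᵥ x) j := by
    intro j
    refine Continuous.measurable ?_
    unfold directStrong
    fun_prop
  have h1 : ∀ j, Integrable (fun hd : Fin K → Fin NB → ℂ => ‖((directStrong hd)ᴴ *ᵥ x) j‖ ^ 2)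
      (Measure.pi fun k => iidRayleigh NB (Ld k)) := by
    intro j
    have := integrable_norm_sq_complexNormal hx
    rw [← map_conjTranspose_directStrong_mulVec hLd x j] at this
    exact this.comp_measurable (hm j)
  refine ⟨integrable_finsetSum _ fun j _ => h1 j, ?_⟩
  rw [integral_finsetSum _ fun j _ => h1 j]
  have h2 : ∀ j, ∫ hd : Fin K → Fin NB → ℂ, ‖((directStrong hd)ᴴ *ᵥ x) j‖ ^ 2
      ∂(Measure.pi fun k => iidRayleigh NB (Ld k)) = ∑ k, ‖x k‖ ^ 2 * Ld k := by
    intro j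
    rw [← integral_norm_sq_complexNormal hx, ← map_conjTranspose_directStrong_mulVec hLd x j,
      integral_map (hm j).aemeasurable (Measurable.aestronglyMeasurable (by fun_prop))]
  simp [h2]

/-- Cauchy–Schwarz against `x`, then Jensen's formula in the phase `t`. Dropping the projector in
`‖P H_d^H x‖` only enlarges `q`. -/
theorem log_add_le_circle_integral_logLoss (hb : ∑ i, ‖b i‖ ^ 2 = 1)
    {hd : Fin K → Fin NB → ℂ} (hdet : (gramStrong b hd).det ≠ 0) {w x : Fin K → ℂ} {s : ℝ}
    (hs : 0 < s) (hxw : star x ⬝ᵥ w = s) (hNB : 0 < NB) :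
    Real.log s - Real.log NB + 1 - (∑ j, ‖((directStrong hd)ᴴ *ᵥ x) j‖ ^ 2) / (NB * s)
      ≤ (2 * Real.pi)⁻¹ * ∫ t in (0 : ℝ)..(2 * Real.pi),
          logLoss b (hd, Complex.exp (t * Complex.I) • w) := by
  have hNB' : (0 : ℝ) < NB := by exact_mod_cast hNB
  set q := ∑ j, ‖((directStrong hd)ᴴ *ᵥ x) j‖ ^ 2 with hq
  set g := star x ⬝ᵥ (directStrong hd *ᵥ b) with hg
  set F : ℝ → ℝ := fun t =>
    strongForm b hd (Complex.exp (t * Complex.I) • w + directStrong hd *ᵥ b) with hF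
  have hF0 : ∀ t, 0 ≤ F t := fun t => strongForm_nonneg hb _ _
  have hFc : Continuous F := (continuous_strongForm b hd).comp (by fun_prop)
  have hle : ∀ t : ℝ, ‖Complex.exp (t * Complex.I) * s + g‖ ^ 2 ≤ q * F t := by
    intro t
    have h1 := sq_norm_le_mul_strongForm hb hdet x
      (Complex.exp (t * Complex.I) • w + directStrong hd *ᵥ b)
    rw [dotProduct_add, dotProduct_smul, hxw, smul_eq_mul] at h1
    refine h1.trans (mul_le_mul_of_nonneg_right ?_ (hF0 t))
    rw [Matrix.conjTranspose_mul, conjTranspose_projOrth, ← Matrix.mulVec_mulVec]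
    exact sum_sq_norm_projOrth_mulVec_le hb _
  -- If `q = 0`, then `exp (i t) s + g` vanishes for all `t`; comparing `t = 0` with `t = π`
  -- contradicts `s > 0`.
  have hq0 : 0 < q := by
    refine lt_of_le_of_ne (by positivity) fun h0 => ?_
    have h1 : ∀ t : ℝ, Complex.exp (t * Complex.I) * s + g = 0 := by
      intro t
      have := hle t
      rw [← h0, zero_mul] at this
      have h2 := sq_nonneg ‖Complex.exp (t * Complex.I) * s + g‖
      simpa using le_antisymm this h2
    have h2 := h1 0
    have h3 := h1 Real.pi
    rw [Complex.exp_pi_mul_I] at h3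
    simp only [Complex.ofReal_zero, zero_mul, Complex.exp_zero, one_mul] at h2
    have h4 : (2 : ℂ) * s = 0 := by linear_combination h2 - h3
    simp [hs.ne'] at h4
  have h1 := two_mul_log_le_circle_integral hs hq0 g hFc hF0 hle
  refine le_trans ?_ h1
  -- Linearises `log q`. When `∑ k, ‖x k‖ ^ 2 * Ld k = s`, the ratio has mean one over `H_d`, so the
  -- correction then vanishes on average.
  have h2 := Real.log_le_sub_one_of_pos (by positivity : 0 < q / (NB * s))
  rw [Real.log_div hq0.ne' (by positivity), Real.log_mul hNB'.ne' hs.ne'] at h2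
  linarith

theorem map_smul_pi_complexNormal (hσ : ∀ k, 0 < σ k) {c : ℂ} (hc : ‖c‖ = 1) :
    (Measure.pi fun k => complexNormal (σ k)).map (fun w => c • w)
      = Measure.pi fun k => complexNormal (σ k) := by
  have h1 : ∀ k, (complexNormal (σ k)).map (c * ·) = complexNormal (σ k) := by
    intro k
    rw [map_mul_complexNormal (hσ k).le, hc, one_pow, one_mul]
  have h := Measure.pi_map_pi (μ := fun k => complexNormal (σ k)) (f := fun _ => (c * ·))
    (hμ := fun k => by rw [h1]; infer_instance) (fun _ => by fun_prop)
  simp only [h1] at h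
  exact h

/-- Concavity of the logarithm, with weights proportional to `σ k / Ld k` and points `‖w k‖^2 / σ
k`, whose logarithms all have mean `-γ`. -/
theorem log_sum_add_le (hσ : ∀ k, 0 < σ k) (hLd : ∀ k, 0 < Ld k) (hK : 0 < K) {w : Fin K → ℂ}
    (hw : ∀ k, w k ≠ 0) :
    Real.log (∑ k, σ k / Ld k)
        + ∑ k, (σ k / Ld k) / (∑ l, σ l / Ld l) * Real.log (‖w k‖ ^ 2 / σ k)
      ≤ Real.log (∑ k, ‖w k‖ ^ 2 / Ld k) := by
  have : Nonempty (Fin K) := ⟨⟨0, hK⟩⟩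
  have hc : ∀ k, 0 < σ k / Ld k := fun k => div_pos (hσ k) (hLd k)
  set c := ∑ l, σ l / Ld l with hcdef
  have hc0 : 0 < c := Finset.sum_pos (fun k _ => hc k) Finset.univ_nonempty
  have hwp : ∀ k, 0 < ‖w k‖ ^ 2 := fun k => by have := norm_pos_iff.2 (hw k); positivity
  have h := strictConcaveOn_log_Ioi.concaveOn.le_map_sum (t := Finset.univ)
    (w := fun k => (σ k / Ld k) / c) (p := fun k => ‖w k‖ ^ 2 / σ k)
    (fun k _ => (div_pos (hc k) hc0).le)
    (by rw [← Finset.sum_div, div_self hc0.ne']) (fun k _ => div_pos (hwp k) (hσ k))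
  simp only [smul_eq_mul] at h
  have h2 : ∑ k, (σ k / Ld k) / c * (‖w k‖ ^ 2 / σ k) = (∑ k, ‖w k‖ ^ 2 / Ld k) / c := by
    rw [Finset.sum_div]
    refine Finset.sum_congr rfl fun k _ => ?_
    have := (hσ k).ne'
    have := (hLd k).ne'
    field_simp
  have h3 : 0 < ∑ k, ‖w k‖ ^ 2 / Ld k :=
    Finset.sum_pos (fun k _ => div_pos (hwp k) (hLd k)) Finset.univ_nonempty
  rw [h2, Real.log_div h3.ne' hc0.ne'] at h
  linarith

theorem ae_forall_ne_zero_pi_complexNormal (hσ : ∀ k, 0 < σ k) :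
    ∀ᵐ w ∂(Measure.pi fun k => complexNormal (σ k)), ∀ k, w k ≠ 0 :=
  ae_all_iff.2 fun k => (Measure.quasiMeasurePreserving_eval
    (fun k => complexNormal (σ k)) k).ae (ae_ne_zero_complexNormal (hσ k))

theorem integral_weighted_log (hσ : ∀ k, 0 < σ k) (p : Fin K → ℝ) :
    Integrable (fun w : Fin K → ℂ => ∑ k, p k * Real.log (‖w k‖ ^ 2 / σ k))
        (Measure.pi fun k => complexNormal (σ k)) ∧
      ∫ w, ∑ k, p k * Real.log (‖w k‖ ^ 2 / σ k) ∂(Measure.pi fun k => complexNormal (σ k))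
        = -(∑ k, p k) * Real.eulerMascheroniConstant := by
  have h1 : ∀ k, Integrable (fun w : Fin K → ℂ => p k * Real.log (‖w k‖ ^ 2 / σ k))
      (Measure.pi fun k => complexNormal (σ k)) := fun k =>
    (integrable_comp_eval (μ := fun k => complexNormal (σ k))
      (integrable_log_norm_sq_complexNormal (hσ k))).const_mul (p k)
  refine ⟨integrable_finsetSum _ fun k _ => h1 k, ?_⟩
  rw [integral_finsetSum _ fun k _ => h1 k, neg_mul, Finset.sum_mul, ← Finset.sum_neg_distrib]
  refine Finset.sum_congr rfl fun k _ => ?_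
  rw [integral_const_mul, integral_comp_eval (μ := fun k => complexNormal (σ k))
    (f := fun z => Real.log (‖z‖ ^ 2 / σ k)) (Measurable.aestronglyMeasurable (by fun_prop)),
    integral_log_norm_sq_complexNormal (hσ k)]
  ring

theorem le_integral_logLoss (hb : ∑ i, ‖b i‖ ^ 2 = 1) (hK : 1 ≤ K) (hNB : K + 1 ≤ NB)
    (hLd : ∀ k, 0 < Ld k) (hσ : ∀ k, 0 < σ k) :
    Real.log (∑ k, σ k / Ld k) - Real.eulerMascheroniConstant - Real.log NB
      ≤ ∫ p, logLoss b p ∂((Measure.pi fun k => iidRayleigh NB (Ld k)).prod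
          (Measure.pi fun k => complexNormal (σ k))) := by
  have hNBpos : (0 : ℝ) < NB := by exact_mod_cast (by omega : 0 < NB)
  have hint := integrable_logLoss hb hNB hLd hσ
  have hdet := ae_gramStrong_det_ne_zero hb hNB hLd
  set μd := Measure.pi fun k => iidRayleigh NB (Ld k) with hμd
  set ν := Measure.pi fun k => complexNormal (σ k) with hν
  have hnorm : ∀ t : ℝ, ‖Complex.exp (t * Complex.I)‖ = 1 := Complex.norm_exp_ofReal_mul_I
  -- Circular symmetry: a common phase on all `w k` leaves the joint law unchanged, so the mean loss
  -- equals the mean of its phase average `A`.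
  have hmp : ∀ t : ℝ, MeasurePreserving
      (fun p : (Fin K → Fin NB → ℂ) × (Fin K → ℂ) => (p.1, Complex.exp (t * Complex.I) • p.2))
      (μd.prod ν) (μd.prod ν) := fun t =>
    (MeasurePreserving.id μd).prod
      ⟨by fun_prop, map_smul_pi_complexNormal hσ (hnorm t)⟩
  set G : ℝ → (Fin K → Fin NB → ℂ) × (Fin K → ℂ) → ℝ :=
    fun t p => logLoss b (p.1, Complex.exp (t * Complex.I) • p.2) with hG
  have hGm : Measurable (Function.uncurry G) := by
    have : Continuous fun x : ℝ × ((Fin K → Fin NB → ℂ) × (Fin K → ℂ)) =>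
        (x.2.1, Complex.exp (x.1 * Complex.I) • x.2.2) := by fun_prop
    exact (measurable_logLoss b).comp this.measurable
  have hGt : ∀ t, Integrable (G t) (μd.prod ν) := fun t => (hmp t).integrable_comp_of_integrable hint
  have hGi : ∀ t, ∫ p, G t p ∂(μd.prod ν) = ∫ p, logLoss b p ∂(μd.prod ν) := fun t => by
    conv_rhs => rw [← (hmp t).map_eq]
    rw [integral_map (hmp t).measurable.aemeasurable
      (measurable_logLoss b).aestronglyMeasurable]
  have hGint : Integrable (Function.uncurry G)
      ((volume.restrict (Set.uIoc 0 (2 * Real.pi))).prod (μd.prod ν)) := by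
    rw [integrable_prod_iff hGm.aestronglyMeasurable]
    refine ⟨Filter.Eventually.of_forall hGt, ?_⟩
    have : (fun t => ∫ p, ‖Function.uncurry G (t, p)‖ ∂(μd.prod ν))
        = fun _ => ∫ p, logLoss b p ∂(μd.prod ν) := by
      ext t
      rw [← hGi t]
      refine integral_congr_ae (Filter.Eventually.of_forall fun p => ?_)
      exact abs_of_nonneg (logLoss_nonneg hb _)
    rw [this, Set.uIoc_of_le Real.two_pi_pos.le]
    exact integrable_const _
  set A : (Fin K → Fin NB → ℂ) × (Fin K → ℂ) → ℝ :=
    fun p => (2 * Real.pi)⁻¹ * ∫ t in (0 : ℝ)..(2 * Real.pi), G t p with hA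
  have hAint : Integrable A (μd.prod ν) := by
    refine Integrable.const_mul ?_ _
    have := hGint.integral_prod_right
    simp only [intervalIntegral.integral_of_le Real.two_pi_pos.le]
    rwa [Set.uIoc_of_le Real.two_pi_pos.le] at this
  have hAeq : ∫ p, logLoss b p ∂(μd.prod ν) = ∫ p, A p ∂(μd.prod ν) := by
    rw [hA, integral_const_mul, ← intervalIntegral_integral_swap hGint]
    simp only [hGi, intervalIntegral.integral_const, smul_eq_mul, sub_zero]
    field_simp
  rw [hAeq, integral_prod_symm _ hAint]
  set c := ∑ k, σ k / Ld k with hc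
  have : Nonempty (Fin K) := ⟨⟨0, by omega⟩⟩
  have hc0 : 0 < c := Finset.sum_pos (fun k _ => div_pos (hσ k) (hLd k)) Finset.univ_nonempty
  obtain ⟨hJ1, hJ2⟩ := integral_weighted_log hσ fun k => (σ k / Ld k) / c
  rw [← Finset.sum_div, div_self hc0.ne'] at hJ2
  have hJ : ∫ w, (Real.log c - Real.log NB
        + ∑ k, (σ k / Ld k) / c * Real.log (‖w k‖ ^ 2 / σ k)) ∂ν
      = Real.log c - Real.eulerMascheroniConstant - Real.log NB := by
    rw [integral_add (integrable_const _) hJ1, hJ2]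
    simp
    ring
  rw [← hJ]
  refine integral_mono_ae ((integrable_const _).add hJ1) hAint.integral_prod_right ?_
  filter_upwards [hAint.prod_left_ae, ae_forall_ne_zero_pi_complexNormal hσ] with w hAw hw
  have hwp : ∀ k, 0 < ‖w k‖ ^ 2 := fun k => by have := norm_pos_iff.2 (hw k); positivity
  set s := ∑ k, ‖w k‖ ^ 2 / Ld k with hs
  have hs0 : 0 < s := Finset.sum_pos (fun k _ => div_pos (hwp k) (hLd k)) Finset.univ_nonempty
  -- This choice maximises `|x^H w|^2 / ∑ |x k|^2 Ld k`; numerator and denominator become `s^2` and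
  -- `s`.
  let x : Fin K → ℂ := fun k => ((Ld k)⁻¹ : ℝ) * w k
  have hx1 : star x ⬝ᵥ w = s := by
    simp only [dotProduct, x, hs, Pi.star_apply, star_mul', Complex.star_def, Complex.conj_ofReal]
    push_cast
    refine Finset.sum_congr rfl fun k _ => ?_
    rw [mul_assoc, ← Complex.normSq_eq_conj_mul_self, Complex.normSq_eq_norm_sq]
    push_cast
    ring
  have hx2 : ∑ k, ‖x k‖ ^ 2 * Ld k = s := by
    refine Finset.sum_congr rfl fun k _ => ?_
    have := (hLd k).ne'
    simp only [x, norm_mul, Complex.norm_real, Real.norm_eq_abs, mul_pow, sq_abs]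
    field_simp
  obtain ⟨hq1, hq2⟩ := integrable_sum_sq_norm_directStrong (NB := NB) hLd (hx2 ▸ hs0)
  rw [hx2] at hq2
  have hmain : ∫ hd, (Real.log s - Real.log NB + 1
      - (∑ j, ‖((directStrong hd)ᴴ *ᵥ x) j‖ ^ 2) / (NB * s)) ∂μd ≤ ∫ hd, A (hd, w) ∂μd := by
    refine integral_mono_ae ((integrable_const _).sub (hq1.div_const _)) hAw ?_
    filter_upwards [hdet] with hd hhd
    exact log_add_le_circle_integral_logLoss hb hhd hs0 hx1 (by omega)
  rw [integral_sub (integrable_const _) (hq1.div_const _), integral_div, hq2,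
    div_self (by positivity)] at hmain
  simp only [integral_const, probReal_univ, one_smul] at hmain
  have := log_sum_add_le hσ hLd (by omega) hw
  linarith

end LowerBound

/-! ### Joint law of the direct channels and the effective scalar channels. -/

section Law

theorem map_prod_eq_of_ae_map_eq {α β γ : Type*} [MeasurableSpace α] [MeasurableSpace β]
    [MeasurableSpace γ] {μ : Measure α} {ν : Measure β} {ρ : Measure γ} [IsProbabilityMeasure μ]
    [SFinite ν] {F : α × β → γ} (hF : Measurable F)
    (h : ∀ᵐ x ∂μ, ν.map (fun y => F (x, y)) = ρ) : (μ.prod ν).map F = ρ := by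
  refine Measure.ext_of_lintegral _ fun f hf => ?_
  rw [lintegral_map hf hF, lintegral_prod _ (by exact (hf.comp hF).aemeasurable)]
  have h1 : ∀ᵐ x ∂μ, ∫⁻ y, f (F (x, y)) ∂ν = ∫⁻ z, f z ∂ρ := by
    filter_upwards [h] with x hx
    rw [← hx, lintegral_map hf (by exact hF.comp measurable_prodMk_left)]
  rw [lintegral_congr_ae h1]
  simp

theorem cascadedRow_dotProduct {NR : ℕ} (NB : ℕ) (LG : ℝ) (a h θ : Fin NR → ℂ) :
    cascadedRow NB LG a h ⬝ᵥ θ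
      = ∑ n, (√ (LG * NB) * (a n * θ n) : ℂ) * star h n := by
  simp only [cascadedRow, dotProduct, Pi.smul_apply, Matrix.vecMul_diagonal, smul_eq_mul]
  exact Finset.sum_congr rfl fun n _ => by ring

theorem map_cascadedRow_dotProduct {NR NB : ℕ} {LG L : ℝ} (hLG : 0 < LG) (hL : 0 < L)
    {a θ : Fin NR → ℂ} (ha : ∑ n, ‖a n‖ ^ 2 = NR) (hθ : ∀ n, ‖θ n‖ = 1) :
    (iidRayleigh NR L).map (fun h => cascadedRow NB LG a h ⬝ᵥ θ)
      = complexNormal (LG * NB * NR * L) := by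
  have hm : Measurable fun z : Fin NR → ℂ => ∑ n, (√ (LG * NB) * (a n * θ n) : ℂ) * z n :=
    Continuous.measurable (by fun_prop)
  simp only [cascadedRow_dotProduct]
  have h1 : (fun h : Fin NR → ℂ => ∑ n, (√ (LG * NB) * (a n * θ n) : ℂ) * star h n)
      = (fun z : Fin NR → ℂ => ∑ n, (√ (LG * NB) * (a n * θ n) : ℂ) * z n) ∘ star := rfl
  rw [h1, ← Measure.map_map hm (by fun_prop), map_star_iidRayleigh NR hL.le, iidRayleigh,
    map_sum_mul_complexNormal fun _ => hL.le]
  congr 1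
  have h2 : ∀ n, ‖(√ (LG * NB) * (a n * θ n) : ℂ)‖ ^ 2 * L = ‖a n‖ ^ 2 * (LG * NB * L) := by
    intro n
    rw [norm_mul, norm_mul, hθ, mul_one, mul_pow, Complex.norm_real, Real.norm_eq_abs, sq_abs,
      Real.sq_sqrt (by positivity)]
    ring
  simp_rw [h2]
  rw [← Finset.sum_mul, ha]
  ring

/-- Conditioned on `θ`, the scalars are Gaussian with variances that involve `θ` only through `‖θ n‖
= 1`. The conditional law is therefore constant and equals the unconditional one. -/
theorem map_channels_eq {K NB NR : ℕ} {LG : ℝ} (hLG : 0 < LG)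
    {Ld : Fin K → ℝ} {Lr : Fin (K + 1) → ℝ} (hLr : ∀ k, 0 < Lr k)
    {a : Fin NR → ℂ} (ha : ∑ n, ‖a n‖ ^ 2 = NR)
    {Ω : Type*} [MeasurableSpace Ω] {μ : Measure Ω} [IsProbabilityMeasure μ]
    {hd : Fin K → Ω → Fin NB → ℂ} {hr : Fin (K + 1) → Ω → Fin NR → ℂ} {θ : Ω → Fin NR → ℂ}
    (hdl : ∀ k, HasLaw (hd k) (iidRayleigh NB (Ld k)) μ)
    (hrl : ∀ k, HasLaw (hr k) (iidRayleigh NR (Lr k)) μ)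
    (hdi : iIndepFun hd μ) (hri : iIndepFun hr μ)
    (hdr : IndepFun (fun ω k => hd k ω) (fun ω k => hr k ω) μ)
    (hθm : AEMeasurable θ μ) (hθ : ∀ᵐ ω ∂μ, ∀ n, ‖θ ω n‖ = 1)
    (hθi : IndepFun θ (fun ω => ((fun k => hd k ω), (fun k => hr k ω))) μ) :
    AEMeasurable (fun ω => ((fun k => hd k ω), fun k => cascadedRow NB LG a (hr k ω) ⬝ᵥ θ ω)) μ ∧
    μ.map (fun ω => ((fun k => hd k ω), fun k => cascadedRow NB LG a (hr k ω) ⬝ᵥ θ ω))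
      = (Measure.pi fun k => iidRayleigh NB (Ld k)).prod
          (Measure.pi fun k => complexNormal (LG * NB * NR * Lr k)) := by
  have hdm : AEMeasurable (fun ω k => hd k ω) μ :=
    aemeasurable_pi_lambda _ fun k => (hdl k).aemeasurable
  have hrm : AEMeasurable (fun ω k => hr k ω) μ :=
    aemeasurable_pi_lambda _ fun k => (hrl k).aemeasurable
  have hd_law : μ.map (fun ω k => hd k ω) = Measure.pi fun k => iidRayleigh NB (Ld k) := by
    rw [hdi.map_fun_eq_pi_map fun k => (hdl k).aemeasurable]
    simp only [fun k => (hdl k).map_eq]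
  have hr_law : μ.map (fun ω k => hr k ω) = Measure.pi fun k => iidRayleigh NR (Lr k) := by
    rw [hri.map_fun_eq_pi_map fun k => (hrl k).aemeasurable]
    simp only [fun k => (hrl k).map_eq]
  have hjoint := hθi.map_prod_eq_prod_map_map hθm (hdm.prodMk hrm)
  rw [hdr.map_prod_eq_prod_map_map hdm hrm, hd_law, hr_law] at hjoint
  have hθ' : ∀ᵐ x ∂(μ.map θ), ∀ n, ‖x n‖ = 1 := by
    rw [ae_map_iff hθm]
    · exact hθ
    · have : {x : Fin NR → ℂ | ∀ n, ‖x n‖ = 1} = ⋂ n, {x | ‖x n‖ = 1} := by ext; simp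
      rw [this]
      exact MeasurableSet.iInter fun n => measurableSet_eq_fun (by fun_prop) (by fun_prop)
  have : IsProbabilityMeasure (μ.map θ) := Measure.isProbabilityMeasure_map hθm
  set F : (Fin NR → ℂ) × ((Fin K → Fin NB → ℂ) × (Fin (K + 1) → Fin NR → ℂ)) →
      (Fin K → Fin NB → ℂ) × (Fin (K + 1) → ℂ) :=
    fun x => (x.2.1, fun k => cascadedRow NB LG a (x.2.2 k) ⬝ᵥ x.1) with hF
  have hFm : Measurable F := by
    refine Continuous.measurable ?_
    simp only [hF, cascadedRow_dotProduct]
    fun_prop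
  have hm := hθm.prodMk (hdm.prodMk hrm)
  refine ⟨hFm.comp_aemeasurable hm, ?_⟩
  have h1 : (fun ω => ((fun k => hd k ω), fun k => cascadedRow NB LG a (hr k ω) ⬝ᵥ θ ω))
      = F ∘ fun ω => (θ ω, ((fun k => hd k ω), (fun k => hr k ω))) := rfl
  rw [h1, ← AEMeasurable.map_map_of_aemeasurable hFm.aemeasurable hm, hjoint]
  refine map_prod_eq_of_ae_map_eq hFm ?_
  filter_upwards [hθ'] with x hx
  have hcm : Measurable fun h : Fin NR → ℂ => cascadedRow NB LG a h ⬝ᵥ x := by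
    refine Continuous.measurable ?_
    simp only [cascadedRow_dotProduct]
    fun_prop
  have h2 := Measure.pi_map_pi (μ := fun k => iidRayleigh NR (Lr k))
    (f := fun _ (h : Fin NR → ℂ) => cascadedRow NB LG a h ⬝ᵥ x)
    (hμ := fun k => by rw [map_cascadedRow_dotProduct hLG (hLr k) ha hx]; infer_instance)
    (fun _ => hcm.aemeasurable)
  simp only [fun k => map_cascadedRow_dotProduct (NB := NB) hLG (hLr k) ha hx] at h2
  have h3 : Measurable fun (h : Fin (K + 1) → Fin NR → ℂ) k => cascadedRow NB LG a (h k) ⬝ᵥ x :=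
    measurable_pi_lambda _ fun k => hcm.comp (measurable_pi_apply k)
  rw [← h2]
  exact (((MeasurePreserving.id (Measure.pi fun k => iidRayleigh NB (Ld k))).prod
    (⟨h3, rfl⟩ : MeasurePreserving _ (Measure.pi fun k => iidRayleigh NR (Lr k)) _))).map_eq

theorem measurePreserving_castSucc {K : ℕ} (σ : Fin (K + 1) → ℝ) :
    MeasurePreserving (fun (w : Fin (K + 1) → ℂ) (k : Fin K) => w k.castSucc)
      (Measure.pi fun k => complexNormal (σ k))
      (Measure.pi fun k : Fin K => complexNormal (σ k.castSucc)) := by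
  have h := measurePreserving_snd.comp
    (measurePreserving_piFinSuccAbove (fun k => complexNormal (σ k)) (Fin.last K))
  simp only [Fin.succAbove_last] at h
  convert h using 1
  ext w k
  simp [MeasurableEquiv.piFinSuccAbove, Fin.insertNthEquiv, Fin.init]

end Law

/-! ### Splitting the spectral efficiencies into logarithmic terms. -/

section SpectralEfficiency

variable {K NB NR : ℕ}

/-- The logarithm splits only where the effective channel is nonzero. In the application `σ` is its
variance, so the second term has mean `-γ`. -/
theorem SEDPCR_eq_of_ne_zero {LG p σ : ℝ} (hp : 0 < p) (hσ : 0 < σ) {a : Fin NR → ℂ}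
    {hr : Fin (K + 1) → Fin NR → ℂ} {θ : Fin NR → ℂ}
    (h : cascadedRow NB LG a (hr (Fin.last K)) ⬝ᵥ θ ≠ 0) :
    SEDPCR NB LG p a hr θ = (Real.log (σ * p)
      + Real.log (‖cascadedRow NB LG a (hr (Fin.last K)) ⬝ᵥ θ‖ ^ 2 / σ)) / Real.log 2 := by
  rw [SEDPCR, Real.logb, weakGain]
  have h1 := norm_pos_iff.2 h
  generalize ‖cascadedRow NB LG a (hr (Fin.last K)) ⬝ᵥ θ‖ = n at h1 ⊢
  rw [← Real.log_mul (by positivity) (by positivity)]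
  congr 2
  field_simp

theorem SELinR_eq_of_ne_zero {LG p σ : ℝ} (hp : 0 < p) (hσ : 0 < σ) {a : Fin NR → ℂ}
    {b : Fin NB → ℂ} (hb : ∑ i, ‖b i‖ ^ 2 = 1) {hd : Fin K → Fin NB → ℂ}
    {hr : Fin (K + 1) → Fin NR → ℂ} {θ : Fin NR → ℂ}
    (h : cascadedRow NB LG a (hr (Fin.last K)) ⬝ᵥ θ ≠ 0) :
    SELinR LG p a b hd hr θ = (Real.log (σ * p)
      + Real.log (‖cascadedRow NB LG a (hr (Fin.last K)) ⬝ᵥ θ‖ ^ 2 / σ)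
      - logLoss b (hd, fun k => cascadedRow NB LG a (hr k.castSucc) ⬝ᵥ θ)) / Real.log 2 := by
  rw [SELinR, Real.logb, weakGain, mitigation_eq, logLoss]
  have h2 := strongForm_nonneg hb hd
    ((fun k => cascadedRow NB LG a (hr k.castSucc) ⬝ᵥ θ) + directStrong hd *ᵥ b)
  have h1 := norm_pos_iff.2 h
  generalize ‖cascadedRow NB LG a (hr (Fin.last K)) ⬝ᵥ θ‖ = n at h1 ⊢
  generalize strongForm b hd
    ((fun k => cascadedRow NB LG a (hr k.castSucc) ⬝ᵥ θ) + directStrong hd *ᵥ b) = M at h2 ⊢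
  rw [← Real.log_mul (by positivity) (by positivity), ← Real.log_div (by positivity) (by positivity)]
  congr 2
  field_simp

end SpectralEfficiency

end RISDownlink

end

/-! ### The ergodic spectral efficiencies. -/

theorem corollary1
    -- `K` strong users plus one weak user, and a base station that can serve all of them
    (K NB : ℕ) (hK : 1 ≤ K) (hNB : K + 1 ≤ NB)
    -- pathlosses and power per user
    (LG p : ℝ) (hLG : 0 < LG) (hp : 0 < p)
    (Ld : Fin K → ℝ) (hLd : ∀ k, 0 < Ld k)
    (Lr : Fin (K + 1) → ℝ) (hLr : ∀ k, 0 < Lr k)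
    -- the steering vector of the base station
    (b : Fin NB → ℂ) (hb : ∑ i, ‖b i‖ ^ 2 = 1) :
    (∀ (NR : ℕ) (_ : 1 ≤ NR)
      -- the steering vector of the RIS
      (a : Fin NR → ℂ) (_ : ∑ n, ‖a n‖ ^ 2 = NR)
      (Ω : Type*) [MeasurableSpace Ω] (μ : Measure Ω) [IsProbabilityMeasure μ]
      (hd : Fin K → Ω → Fin NB → ℂ) (hr : Fin (K + 1) → Ω → Fin NR → ℂ)
      (θ : Ω → Fin NR → ℂ)
      -- i.i.d. Rayleigh fading, all channels mutually independent
      (_ : ∀ k, HasLaw (hd k) (RISDownlink.iidRayleigh NB (Ld k)) μ)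
      (_ : ∀ k, HasLaw (hr k) (RISDownlink.iidRayleigh NR (Lr k)) μ)
      (_ : iIndepFun hd μ) (_ : iIndepFun hr μ)
      (_ : IndepFun (fun ω k => hd k ω) (fun ω k => hr k ω) μ)
      -- phase shifts with unit modulus, independent of the channels: random phases of any
      -- law, and (as the case of a constant `θ`) phases fixed by the channel statistics
      (_ : AEMeasurable θ μ) (_ : ∀ᵐ ω ∂μ, ∀ n, ‖θ ω n‖ = 1)
      (_ : IndepFun θ (fun ω => ((fun k => hd k ω), (fun k => hr k ω))) μ),
      (Integrable (fun ω => RISDownlink.SELinR LG p a b (fun k => hd k ω)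
            (fun k => hr k ω) (θ ω)) μ ∧
        ∫ ω, RISDownlink.SELinR LG p a b (fun k => hd k ω) (fun k => hr k ω) (θ ω) ∂μ
          ≤ Real.logb 2 (NB * (Lr (Fin.last K) * p / ∑ k, Lr k.castSucc / Ld k))) ∧
      (Integrable (fun ω => RISDownlink.SEDPCR NB LG p a (fun k => hr k ω) (θ ω)) μ ∧
        ∫ ω, RISDownlink.SEDPCR NB LG p a (fun k => hr k ω) (θ ω) ∂μ
          = Real.logb 2 (Real.exp (-Real.eulerMascheroniConstant) * LG * Lr (Fin.last K)
              * NB * NR * p))) ∧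
    -- the value for dirty paper coding increases with the number of reflecting elements
    StrictMonoOn (fun NR : ℕ => Real.logb 2 (Real.exp (-Real.eulerMascheroniConstant) * LG
      * Lr (Fin.last K) * NB * NR * p)) (Set.Ici 1) := by
  have hNBpos : (0 : ℝ) < NB := by exact_mod_cast (by omega : 0 < NB)
  have hLlast := hLr (Fin.last K)
  have hlog2 : 0 < Real.log 2 := Real.log_pos one_lt_two
  refine ⟨?_, ?_⟩
  · intro NR hNR a ha Ω _ μ _ hd hr θ hdl hrl hdi hri hdr hθm hθ hθi
    have hNRpos : (0 : ℝ) < NR := by exact_mod_cast hNR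
    obtain ⟨hm, hlaw⟩ := RISDownlink.map_channels_eq hLG hLr ha hdl hrl hdi hri hdr hθm hθ hθi
    set X := fun ω => ((fun k => hd k ω),
      fun k => RISDownlink.cascadedRow NB LG a (hr k ω) ⬝ᵥ θ ω) with hX
    set μd := Measure.pi fun k => RISDownlink.iidRayleigh NB (Ld k) with hμd
    set σ : Fin (K + 1) → ℝ := fun k => LG * NB * NR * Lr k with hσdef
    have hσ : ∀ k, 0 < σ k := fun k => by have := hLr k; positivity
    -- By linearity of the expectation, the marginal of the strong users and that of the weak user
    -- suffice.
    have hX1 : MeasurePreserving (fun x : (Fin K → Fin NB → ℂ) × (Fin (K + 1) → ℂ) =>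
        (x.1, fun k : Fin K => x.2 k.castSucc))
        (μd.prod (Measure.pi fun k => RISDownlink.complexNormal (σ k)))
        (μd.prod (Measure.pi fun k : Fin K => RISDownlink.complexNormal (σ k.castSucc))) :=
      (MeasurePreserving.id μd).prod (RISDownlink.measurePreserving_castSucc σ)
    have hX2 : MeasurePreserving (fun x : (Fin K → Fin NB → ℂ) × (Fin (K + 1) → ℂ) =>
        x.2 (Fin.last K))
        (μd.prod (Measure.pi fun k => RISDownlink.complexNormal (σ k)))
        (RISDownlink.complexNormal (σ (Fin.last K))) :=
      (measurePreserving_eval (fun k => RISDownlink.complexNormal (σ k)) (Fin.last K)).comp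
        measurePreserving_snd
    have hY1 : AEMeasurable (fun ω => ((X ω).1, fun k : Fin K => (X ω).2 k.castSucc)) μ :=
      hX1.measurable.comp_aemeasurable hm
    have hY1law : μ.map (fun ω => ((X ω).1, fun k : Fin K => (X ω).2 k.castSucc))
        = μd.prod (Measure.pi fun k : Fin K => RISDownlink.complexNormal (σ k.castSucc)) := by
      rw [← hX1.map_eq, ← hlaw, AEMeasurable.map_map_of_aemeasurable hX1.measurable.aemeasurable hm]
      rfl
    have hY2 : AEMeasurable (fun ω => (X ω).2 (Fin.last K)) μ :=
      hX2.measurable.comp_aemeasurable hm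
    have hY2law : μ.map (fun ω => (X ω).2 (Fin.last K))
        = RISDownlink.complexNormal (σ (Fin.last K)) := by
      rw [← hX2.map_eq, ← hlaw, AEMeasurable.map_map_of_aemeasurable hX2.measurable.aemeasurable hm]
      rfl
    set W : Ω → ℝ := fun ω => Real.log (‖(X ω).2 (Fin.last K)‖ ^ 2 / σ (Fin.last K)) with hW
    set V : Ω → ℝ := fun ω =>
      RISDownlink.logLoss b ((X ω).1, fun k : Fin K => (X ω).2 k.castSucc) with hV
    have hWint : Integrable W μ := by
      have := RISDownlink.integrable_log_norm_sq_complexNormal (hσ (Fin.last K))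
      rw [← hY2law] at this
      exact this.comp_aemeasurable hY2
    have hWval : ∫ ω, W ω ∂μ = -Real.eulerMascheroniConstant := by
      rw [← RISDownlink.integral_log_norm_sq_complexNormal (hσ (Fin.last K)), ← hY2law,
        integral_map hY2 (Measurable.aestronglyMeasurable (by fun_prop))]
    have hVint : Integrable V μ := by
      have := RISDownlink.integrable_logLoss hb hNB hLd fun k : Fin K => hσ k.castSucc
      rw [← hμd, ← hY1law] at this
      exact this.comp_aemeasurable hY1
    have hVval : Real.log (∑ k : Fin K, σ k.castSucc / Ld k) - Real.eulerMascheroniConstant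
        - Real.log NB ≤ ∫ ω, V ω ∂μ := by
      have := RISDownlink.le_integral_logLoss hb hK hNB hLd fun k : Fin K => hσ k.castSucc
      rw [← hμd, ← hY1law, integral_map hY1
        (RISDownlink.measurable_logLoss b).aestronglyMeasurable] at this
      exact this
    have hne : ∀ᵐ ω ∂μ, (X ω).2 (Fin.last K) ≠ 0 := by
      have := RISDownlink.ae_ne_zero_complexNormal (hσ (Fin.last K))
      rw [← hY2law] at this
      exact ae_of_ae_map hY2 this
    have hdpc : (fun ω => RISDownlink.SEDPCR NB LG p a (fun k => hr k ω) (θ ω))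
        =ᵐ[μ] fun ω => (Real.log (σ (Fin.last K) * p) + W ω) / Real.log 2 := by
      filter_upwards [hne] with ω hω
      exact RISDownlink.SEDPCR_eq_of_ne_zero hp (hσ (Fin.last K)) hω
    have hlin : (fun ω => RISDownlink.SELinR LG p a b (fun k => hd k ω) (fun k => hr k ω) (θ ω))
        =ᵐ[μ] fun ω => (Real.log (σ (Fin.last K) * p) + W ω - V ω) / Real.log 2 := by
      filter_upwards [hne] with ω hω
      exact RISDownlink.SELinR_eq_of_ne_zero hp (hσ (Fin.last K)) hb hω
    have hsum : ∑ k : Fin K, σ k.castSucc / Ld k = LG * NB * NR * ∑ k, Lr k.castSucc / Ld k := by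
      rw [Finset.mul_sum]
      exact Finset.sum_congr rfl fun k _ => by rw [hσdef, mul_div_assoc]
    have : Nonempty (Fin K) := ⟨⟨0, by omega⟩⟩
    have hr0 : 0 < ∑ k, Lr k.castSucc / Ld k :=
      Finset.sum_pos (fun k _ => div_pos (hLr _) (hLd k)) Finset.univ_nonempty
    refine ⟨⟨?_, ?_⟩, ?_, ?_⟩
    · exact (integrable_congr hlin).2
        ((((integrable_const _).add hWint).sub hVint).div_const _)
    · rw [integral_congr_ae hlin, integral_div, integral_sub (by exact (integrable_const _).add hWint) hVint,
        integral_add (integrable_const _) hWint, hWval, Real.logb]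
      refine div_le_div_of_nonneg_right ?_ hlog2.le
      -- The factor `LG * NB * NR` is split off here from the strong users' sum and next from the
      -- weak user's variance; it cancels in the difference, as does `γ`.
      rw [hsum, Real.log_mul (by positivity) hr0.ne'] at hVval
      have h1 : σ (Fin.last K) * p = (LG * NB * NR) * (Lr (Fin.last K) * p) := by
        rw [hσdef]; ring
      rw [Real.log_mul hNBpos.ne' (by positivity), Real.log_div (by positivity) hr0.ne', h1,
        Real.log_mul (by positivity) (by positivity)]
      simp only [integral_const, probReal_univ, one_smul]
      linarith
    · exact (integrable_congr hdpc).2 (((integrable_const _).add hWint).div_const _)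
    · rw [integral_congr_ae hdpc, integral_div, integral_add (integrable_const _) hWint, hWval,
        Real.logb]
      simp only [integral_const, probReal_univ, one_smul]
      rw [← Real.log_exp (-Real.eulerMascheroniConstant),
        ← Real.log_mul (mul_pos (hσ _) hp).ne' (Real.exp_ne_zero _), Real.log_exp]
      congr 2
      rw [hσdef]
      ring
  · intro m hm n hn hmn
    have hm' : (0 : ℝ) < m := by
      have : 1 ≤ m := hm
      exact_mod_cast this
    refine Real.logb_lt_logb one_lt_two (by positivity) ?_
    have : (m : ℝ) < n := by exact_mod_cast hmn
    gcongr
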